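/- **Conventions.** All 2-categories, 2-functors, 2-monads and adjunctions are strict (i.e. $\mathrm{Cat}$-enriched). An *$\mathcal F$-category* $\mathbb A$ is a 2-category $\mathcal A_\lambda$, whose 1-cells are called *loose* morphisms, together with a class of loose morphisms called *tight* which contains the identities and is closed under composition. Write $\mathcal A_\tau$ for the locally full sub-2-category of tight morphisms (same objects, all 2-cells between tight morphisms) and $j:\mathcal A_\tau\to\mathbb A$ for the inclusion. An *$\mathcal F$-functor* is a 2-functor between the 2-categories of loose morphisms which sends tight morphisms to tight morphisms. A 2-category is regarded as an $\mathcal F$-category in which every 1-cell is tight. **Limits.** Let $f:A\to B$ be a loose morphism of $\mathbb A$. A *colax cone* on $f$ with vertex $X$ is a triple $(r,\alpha,s)$ with $r:X\to A$, $s:X\to B$ loose and $\alpha:s\Rightarrow fr$; a *pseudo-cone* is a colax cone with $\alpha$ invertible; a *lax cone* has instead $\alpha:fr\Rightarrow s$. The colax limit (respectively pseudolimit, lax limit) of $f$ is a colax cone (respectively pseudo-cone, lax cone) $(p,\lambda,q)$ with vertex $L$ and with $p,q$ tight such that: 1. for every cone $(r,\alpha,s)$ of the same kind with vertex $X$ there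 is a unique loose $t:X\to L$ with $pt=r$, $qt=s$ and $\lambda t=\alpha$; 2. for cones $(r,\alpha,s)$ and $(r',\alpha',s')$ of that kind with the same vertex, with factorisations $t,t'$, and 2-cells $\theta_r:r\Rightarrow r'$, $\theta_s:s\Rightarrow s'$ with $(f\theta_r)\cdot\alpha=\alpha'\cdot\theta_s$ (in the lax case, $\theta_s\cdot\alpha=\alpha'\cdot(f\theta_r)$), there is a unique 2-cell $\varphi:t\Rightarrow t'$ with $p\varphi=\theta_r$ and $q\varphi=\theta_s$; 3. a loose morphism $t:X\to L$ is tight if and only if $pt$ and $qt$ are tight. For $w\in\{l,p,c\}$ we say that $\mathbb A$ *admits $\overline w$-limits of loose morphisms* if every loose morphism has a colax limit (when $w=l$), a pseudolimit (when $w=p$), a lax limit (when $w=c$). **Algebras.** For a 2-monad $T$ on a 2-category $\mathcal B$, let $\text{T-Alg}_s$ be the 2-category of strict $T$-algebras $(X,a)$, strict morphisms ($b\cdot Tf=f\cdot a$) and $T$-algebra 2-cells. A *lax morphism* $(f,\bar f):(X,a)\to(Y,b)$ is a 1-cell $f:X\to Y$ with a 2-cell $\bar f:b\cdot Tf\Rightarrow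 f\cdot a$ satisfying the usual unit and multiplication conditions; it is a *pseudomorphism* if $\bar f$ is invertible; a *colax morphism* has instead $\bar f:f\cdot a\Rightarrow b\cdot Tf$. For $w=l,p,c$ let $\text{T-}\mathbb{A}\mathrm{lg}_w$ be the $\mathcal F$-category of strict $T$-algebras whose loose morphisms are respectively the lax, pseudo and colax morphisms, whose tight morphisms are the strict ones (those with $\bar f$ an identity), and whose 2-cells are the 2-cells of $\mathcal B$ compatible with the structure 2-cells. Let $j_w:\text{T-Alg}_s\to\text{T-}\mathbb{A}\mathrm{lg}_w$ be the inclusion, and let $U_s:\text{T-Alg}_s\to\mathcal B$ and $U:\text{T-}\mathbb{A}\mathrm{lg}_w\to\mathcal B$ be the forgetful functors. **Theorem.** Let $H:\mathbb A\to\mathcal B$ be an $\mathcal F$-functor from an $\mathcal F$-category to a 2-category, and suppose that its tight part $H_\tau=Hj:\mathcal A_\tau\to\mathcal B$ has a left 2-adjoint $F$, with unit $\eta$ and counit $\varepsilon$. Let $T=(H_\tau F,\eta,H_\tau\varepsilon F)$ be the induced 2-monad on $\mathcal B$, and let $E:\mathcal A_\tau\to\text{T-Alg}_s$ be the Eilenberg–Moore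 comparison 2-functor, which sends $X$ to $(H_\tau X,H_\tau\varepsilon_X)$ and acts as $H_\tau$ on 1-cells and 2-cells, so that $U_sE=H_\tau$. Let $w\in\{l,p,c\}$ and suppose that $\mathbb A$ admits $\overline w$-limits of loose morphisms. Then there is a unique $\mathcal F$-functor $E_w:\mathbb A\to\text{T-}\mathbb{A}\mathrm{lg}_w$ which extends $E$ and lies over $\mathcal B$, that is, such that $$E_w\,j=j_w\,E\qquad\text{and}\qquad U\,E_w=H .$$ -/

import Mathlib

open CategoryTheory Bicategory

set_option linter.checkUnivs false
universe w v u w₁ v₁ u₁ w₂ v₂ u₂ w₃ v₃ u₃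

namespace CategoryTheory.StrictPseudofunctor

variable {B : Type u₁} [Bicategory.{w₁, v₁} B] {C : Type u₂} [Bicategory.{w₂, v₂} C]

theorem map₂_whiskerLeft_eqToHom (F : StrictPseudofunctor B C) {X Y Z : B} (f : X ⟶ Y)
    {g h : Y ⟶ Z} (α : g ⟶ h) :
    F.map₂ (f ◁ α) =
      eqToHom (F.map_comp f g) ≫ F.map f ◁ F.map₂ α ≫ eqToHom (F.map_comp f h).symm := by
  simp [F.mapComp_eq_eqToIso]

theorem map₂_whiskerRight_eqToHom (F : StrictPseudofunctor B C) {X Y Z : B} {f g : X ⟶ Y}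
    (α : f ⟶ g) (h : Y ⟶ Z) :
    F.map₂ (α ▷ h) =
      eqToHom (F.map_comp f h) ≫ F.map₂ α ▷ F.map h ≫ eqToHom (F.map_comp g h).symm := by
  simp [F.mapComp_eq_eqToIso]

theorem map₂_square (F : StrictPseudofunctor B C) {X Y Y' Z : B} {f f' : X ⟶ Y} {k : Y ⟶ Z}
    {l : X ⟶ Y'} {g g' : Y' ⟶ Z} {α : f ⟶ f'} {β : g ⟶ g'} {e : f ≫ k = l ≫ g}
    {e' : f' ≫ k = l ≫ g'} (h : α ▷ k ≫ eqToHom e' = eqToHom e ≫ l ◁ β)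
    (E : F.map f ≫ F.map k = F.map l ≫ F.map g) (E' : F.map f' ≫ F.map k = F.map l ≫ F.map g') :
    F.map₂ α ▷ F.map k ≫ eqToHom E' = eqToHom E ≫ F.map l ◁ F.map₂ β := by
  have h' := congrArg F.map₂ h
  simp only [PrelaxFunctor.map₂_comp, PrelaxFunctor.map₂_eqToHom, map₂_whiskerLeft_eqToHom,
    map₂_whiskerRight_eqToHom] at h'
  rw [← cancel_epi (eqToHom (F.map_comp f k)), ← cancel_mono (eqToHom (F.map_comp l g').symm)]
  simpa using h'

end CategoryTheory.StrictPseudofunctor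

theorem CategoryTheory.eq_eqToHom_conj {K : Type u} [Category.{v} K] {X Y : K} (hX : X = X)
    (hY : Y = Y) (f : X ⟶ Y) : f = eqToHom hX ≫ f ≫ eqToHom hY := by
  simp

namespace CategoryTheory.Bicategory

variable {K : Type u} [Bicategory.{w, v} K]

theorem whiskerLeft_of_eq {X Y Z : K} {f f' : X ⟶ Y} (h : f = f') {g g' : Y ⟶ Z} (α : g ⟶ g') :
    f ◁ α = eqToHom (by rw [h]) ≫ f' ◁ α ≫ eqToHom (by rw [h]) := by
  subst h; simp

theorem whiskerRight_of_eq {X Y Z : K} {f f' : X ⟶ Y} (α : f ⟶ f') {g g' : Y ⟶ Z} (h : g = g') :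
    α ▷ g = eqToHom (by rw [h]) ≫ α ▷ g' ≫ eqToHom (by rw [h]) := by
  subst h; simp

variable [Bicategory.Strict K]

theorem Strict.whiskerLeft_whiskerLeft {X Y Z W : K} (f : X ⟶ Y) (g : Y ⟶ Z) {h h' : Z ⟶ W}
    (α : h ⟶ h') :
    f ◁ g ◁ α = eqToHom (Strict.assoc f g h).symm ≫ (f ≫ g) ◁ α ≫
      eqToHom (Strict.assoc f g h') := by
  simp [Strict.associator_eqToIso]

theorem Strict.whiskerRight_whiskerRight {X Y Z W : K} {f f' : X ⟶ Y} (α : f ⟶ f') (g : Y ⟶ Z)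
    (h : Z ⟶ W) :
    α ▷ g ▷ h = eqToHom (Strict.assoc f g h) ≫ α ▷ (g ≫ h) ≫
      eqToHom (Strict.assoc f' g h).symm := by
  simp [Strict.associator_eqToIso]

theorem Strict.whiskerLeft_whiskerRight {X Y Z W : K} (f : X ⟶ Y) {g g' : Y ⟶ Z} (α : g ⟶ g')
    (h : Z ⟶ W) :
    f ◁ (α ▷ h) = eqToHom (Strict.assoc f g h).symm ≫ (f ◁ α) ▷ h ≫
      eqToHom (Strict.assoc f g' h) := by
  simp [Strict.associator_eqToIso]

end CategoryTheory.Bicategory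

/-- An `F`-category: a strict 2-category (whose 1-cells are the loose morphisms) with a class of
tight 1-cells containing the identities and closed under composition. -/
structure FCategory where
  Obj : Type u
  [bicategory : Bicategory.{w, v} Obj]
  [strict : Bicategory.Strict Obj]
  IsTight : ∀ {X Y : Obj}, (X ⟶ Y) → Prop
  isTight_id : ∀ X : Obj, IsTight (𝟙 X)
  isTight_comp : ∀ {X Y Z : Obj} (f : X ⟶ Y) (g : Y ⟶ Z),
    IsTight f → IsTight g → IsTight (f ≫ g)

attribute [instance] FCategory.bicategory FCategory.strict

/-- A 2-category regarded as an `F`-category in which every 1-cell is tight. -/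
abbrev FCategory.ofTwoCategory (B : Type u) [Bicategory.{w, v} B] [Bicategory.Strict B] :
    FCategory.{w, v, u} where
  Obj := B
  IsTight _ := True
  isTight_id _ := trivial
  isTight_comp _ _ _ _ := trivial

/-- The objects of the 2-category `𝔸_τ` of tight morphisms of `𝔸`: those of `𝔸`. -/
@[ext]
structure FCategory.Tight (𝔸 : FCategory.{w, v, u}) : Type u where
  obj : 𝔸.Obj

namespace FCategory

variable {𝔸 : FCategory.{w, v, u}}

/-- The tight morphisms of an `F`-category. -/
@[ext]
structure TightHom (X Y : 𝔸.Obj) where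
  hom : X ⟶ Y
  tight : 𝔸.IsTight hom

/-- The 2-cells between tight morphisms: all 2-cells of the ambient 2-category. -/
@[ext]
structure TightHom₂ {X Y : 𝔸.Obj} (f g : TightHom X Y) where
  hom : f.hom ⟶ g.hom

namespace Tight

instance : CategoryStruct.{v} 𝔸.Tight where
  Hom X Y := TightHom X.obj Y.obj
  id X := ⟨𝟙 X.obj, 𝔸.isTight_id X.obj⟩
  comp f g := ⟨f.hom ≫ g.hom, 𝔸.isTight_comp _ _ f.tight g.tight⟩

instance (X Y : 𝔸.Tight) : Category.{w} (X ⟶ Y) where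
  Hom f g := TightHom₂ f g
  id f := ⟨𝟙 f.hom⟩
  comp α β := ⟨α.hom ≫ β.hom⟩
  id_comp α := TightHom₂.ext (Category.id_comp α.hom)
  comp_id α := TightHom₂.ext (Category.comp_id α.hom)
  assoc α β γ := TightHom₂.ext (Category.assoc α.hom β.hom γ.hom)

/-- Invertible 2-cells between tight morphisms. -/
def isoMk {X Y : 𝔸.Tight} {f g : X ⟶ Y} (e : f.hom ≅ g.hom) : f ≅ g where
  hom := ⟨e.hom⟩
  inv := ⟨e.inv⟩
  hom_inv_id := TightHom₂.ext e.hom_inv_id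
  inv_hom_id := TightHom₂.ext e.inv_hom_id

instance : Bicategory.{w, v} 𝔸.Tight where
  homCategory _ _ := inferInstance
  whiskerLeft f _ _ α := ⟨f.hom ◁ α.hom⟩
  whiskerRight α h := ⟨α.hom ▷ h.hom⟩
  associator f g h := isoMk (α_ f.hom g.hom h.hom)
  leftUnitor f := isoMk (λ_ f.hom)
  rightUnitor f := isoMk (ρ_ f.hom)
  whiskerLeft_id f g := TightHom₂.ext (whiskerLeft_id f.hom g.hom)
  whiskerLeft_comp f _ _ _ α β := TightHom₂.ext (whiskerLeft_comp f.hom α.hom β.hom)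
  id_whiskerLeft α := TightHom₂.ext (id_whiskerLeft α.hom)
  comp_whiskerLeft f g _ _ α := TightHom₂.ext (comp_whiskerLeft f.hom g.hom α.hom)
  id_whiskerRight f g := TightHom₂.ext (id_whiskerRight f.hom g.hom)
  comp_whiskerRight α β h := TightHom₂.ext (comp_whiskerRight α.hom β.hom h.hom)
  whiskerRight_id α := TightHom₂.ext (whiskerRight_id α.hom)
  whiskerRight_comp α g h := TightHom₂.ext (whiskerRight_comp α.hom g.hom h.hom)
  whisker_assoc f _ _ α h := TightHom₂.ext (whisker_assoc f.hom α.hom h.hom)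
  whisker_exchange α β := TightHom₂.ext (whisker_exchange α.hom β.hom)
  pentagon f g h i := TightHom₂.ext (pentagon f.hom g.hom h.hom i.hom)
  triangle f g := TightHom₂.ext (triangle f.hom g.hom)

theorem eqToHom_hom {X Y : 𝔸.Tight} {f g : X ⟶ Y} (h : f = g) :
    (eqToHom h).hom = eqToHom (congrArg TightHom.hom h) := by
  subst h; rfl

theorem conj_hom {X Y : 𝔸.Tight} {f f' g g' : X ⟶ Y} (h : f = f') (h' : g' = g) (α : f' ⟶ g') :
    TightHom₂.hom (eqToHom h ≫ α ≫ eqToHom h') = eqToHom (congrArg TightHom.hom h) ≫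
      TightHom₂.hom α ≫ eqToHom (congrArg TightHom.hom h') := by
  subst h h'
  rw [eqToHom_refl, eqToHom_refl, Category.id_comp, Category.comp_id]
  exact eq_eqToHom_conj _ _ _

instance : Bicategory.Strict 𝔸.Tight where
  id_comp f := TightHom.ext (Bicategory.Strict.id_comp f.hom)
  comp_id f := TightHom.ext (Bicategory.Strict.comp_id f.hom)
  assoc f g h := TightHom.ext (Bicategory.Strict.assoc f.hom g.hom h.hom)
  leftUnitor_eqToIso f := Iso.ext (TightHom₂.ext (by
    rw [eqToIso.hom, eqToHom_hom]
    exact congrArg Iso.hom (Bicategory.Strict.leftUnitor_eqToIso f.hom)))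
  rightUnitor_eqToIso f := Iso.ext (TightHom₂.ext (by
    rw [eqToIso.hom, eqToHom_hom]
    exact congrArg Iso.hom (Bicategory.Strict.rightUnitor_eqToIso f.hom)))
  associator_eqToIso f g h := Iso.ext (TightHom₂.ext (by
    rw [eqToIso.hom, eqToHom_hom]
    exact congrArg Iso.hom (Bicategory.Strict.associator_eqToIso f.hom g.hom h.hom)))

end Tight

end FCategory

/-- An `F`-functor: a 2-functor between the 2-categories of loose morphisms which preserves
tightness. -/
structure FFunctor (𝔸 : FCategory.{w₁, v₁, u₁}) (𝔹 : FCategory.{w₂, v₂, u₂}) extends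
    StrictPseudofunctor 𝔸.Obj 𝔹.Obj where
  map_tight : ∀ {X Y : 𝔸.Obj} (f : X ⟶ Y), 𝔸.IsTight f → 𝔹.IsTight (map f)

namespace FFunctor

/-- Composition of `F`-functors, in diagrammatic order. -/
def comp {𝔸 : FCategory.{w₁, v₁, u₁}} {𝔹 : FCategory.{w₂, v₂, u₂}} {𝔻 : FCategory.{w₃, v₃, u₃}}
    (F : FFunctor 𝔸 𝔹) (G : FFunctor 𝔹 𝔻) : FFunctor 𝔸 𝔻 where
  toStrictPseudofunctor := F.toStrictPseudofunctor.comp G.toStrictPseudofunctor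
  map_tight f hf := G.map_tight _ (F.map_tight f hf)

/-- A 2-functor regarded as an `F`-functor between 2-categories. -/
def ofTwoFunctor {B : Type u₁} [Bicategory.{w₁, v₁} B] [Bicategory.Strict B]
    {C : Type u₂} [Bicategory.{w₂, v₂} C] [Bicategory.Strict C] (F : StrictPseudofunctor B C) :
    FFunctor (FCategory.ofTwoCategory B) (FCategory.ofTwoCategory C) where
  toStrictPseudofunctor := F
  map_tight _ _ := trivial

end FFunctor

/-- The inclusion of the 2-category of tight morphisms of `𝔸` in the 2-category of loose
morphisms. -/
def FCategory.tightInclusion (𝔸 : FCategory.{w, v, u}) : StrictPseudofunctor 𝔸.Tight 𝔸.Obj :=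
  .mk'' {
    obj X := X.obj
    map f := f.hom
    map₂ α := α.hom
    map₂_id _ := rfl
    map₂_comp _ _ := rfl
    map_id _ := rfl
    map_comp _ _ := rfl
    map₂_whisker_left f _ _ α := by simp; rfl
    map₂_whisker_right α f := by simp; rfl }

/-- The inclusion `𝔸_τ ⟶ 𝔸` as an `F`-functor. -/
def FCategory.j (𝔸 : FCategory.{w, v, u}) : FFunctor (.ofTwoCategory 𝔸.Tight) 𝔸 where
  toStrictPseudofunctor := 𝔸.tightInclusion
  map_tight f _ := f.tight

/-- The tight part `H_τ` of an `F`-functor to a 2-category. -/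
def FFunctor.tightPart {𝔸 : FCategory.{w₁, v₁, u₁}} {B : Type u₂} [Bicategory.{w₂, v₂} B]
    [Bicategory.Strict B] (H : FFunctor 𝔸 (.ofTwoCategory B)) : StrictPseudofunctor 𝔸.Tight B :=
  𝔸.tightInclusion.comp H.toStrictPseudofunctor

/-- A 2-functor taking tight values on 1-cells factors through the 2-category of tight
morphisms. -/
def FCategory.liftTight {𝔸 : FCategory.{w, v, u}} {B : Type u₁} [Bicategory.{w₁, v₁} B]
    [Bicategory.Strict B] (F : StrictPseudofunctor B 𝔸.Obj)
    (hF : ∀ {X Y : B} (f : X ⟶ Y), 𝔸.IsTight (F.map f)) : StrictPseudofunctor B 𝔸.Tight :=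
  .mk'' {
    obj X := ⟨F.obj X⟩
    map f := ⟨F.map f, hF f⟩
    map₂ α := ⟨F.map₂ α⟩
    map₂_id f := FCategory.TightHom₂.ext (F.map₂_id f)
    map₂_comp α β := FCategory.TightHom₂.ext (F.map₂_comp α β)
    map_id X := FCategory.TightHom.ext (F.map_id X)
    map_comp f g := FCategory.TightHom.ext (F.map_comp f g)
    map₂_whisker_left f _ _ α := FCategory.TightHom₂.ext (by
      rw [FCategory.Tight.conj_hom]
      exact F.map₂_whiskerLeft_eqToHom f α)
    map₂_whisker_right α f := FCategory.TightHom₂.ext (by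
      rw [FCategory.Tight.conj_hom]
      exact F.map₂_whiskerRight_eqToHom α f) }

/-- The three kinds of weakness of a morphism: lax, pseudo and colax. -/
inductive Weakness
  | lax
  | pseudo
  | colax

section Limits

variable {K : Type u} [Bicategory.{w, v} K]

/-- A colax cone `(r, α, s)` with vertex `X` on a 1-cell `f`: the 2-cell goes from `s` to the
composite of `r` followed by `f`. -/
structure ColaxCone {A B : K} (f : A ⟶ B) (X : K) where
  r : X ⟶ A
  s : X ⟶ B
  α : s ⟶ r ≫ f

/-- A lax cone on a 1-cell `f`: the 2-cell goes from the composite of `r` followed by `f` to `s`. -/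
structure LaxCone {A B : K} (f : A ⟶ B) (X : K) where
  r : X ⟶ A
  s : X ⟶ B
  α : r ≫ f ⟶ s

namespace ColaxCone

variable {A B : K} {f : A ⟶ B}

/-- The cone `(r t, α t, s t)` obtained by composing a cone with a 1-cell `t` into its vertex. -/
def precomp {L : K} (c : ColaxCone f L) {X : K} (t : X ⟶ L) : ColaxCone f X where
  r := t ≫ c.r
  s := t ≫ c.s
  α := t ◁ c.α ≫ (α_ t c.r f).inv

/-- Compatibility of 2-cells `θr`, `θs` with the 2-cells of two cones. -/
def Compatible {X : K} (c d : ColaxCone f X) (θr : c.r ⟶ d.r) (θs : c.s ⟶ d.s) : Prop :=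
  c.α ≫ θr ▷ f = θs ≫ d.α

end ColaxCone

namespace LaxCone

variable {A B : K} {f : A ⟶ B}

/-- The cone `(r t, α t, s t)` obtained by composing a cone with a 1-cell `t` into its vertex. -/
def precomp {L : K} (c : LaxCone f L) {X : K} (t : X ⟶ L) : LaxCone f X where
  r := t ≫ c.r
  s := t ≫ c.s
  α := (α_ t c.r f).hom ≫ t ◁ c.α

/-- Compatibility of 2-cells `θr`, `θs` with the 2-cells of two cones. -/
def Compatible {X : K} (c d : LaxCone f X) (θr : c.r ⟶ d.r) (θs : c.s ⟶ d.s) : Prop :=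
  c.α ≫ θs = θr ▷ f ≫ d.α

end LaxCone

end Limits

namespace FCategory

variable (𝔸 : FCategory.{w, v, u})

/-- The projections are tight and jointly detect tightness. -/
structure DetectsTight {A B L : 𝔸.Obj} (p : L ⟶ A) (q : L ⟶ B) : Prop where
  tight_left : 𝔸.IsTight p
  tight_right : 𝔸.IsTight q
  detects : ∀ {X : 𝔸.Obj} (t : X ⟶ L), 𝔸.IsTight t ↔ 𝔸.IsTight (t ≫ p) ∧ 𝔸.IsTight (t ≫ q)

/-- The colax cone `c` exhibits `L` as the colax limit of the loose morphism `f`. -/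
structure IsColaxLimit {A B : 𝔸.Obj} {f : A ⟶ B} {L : 𝔸.Obj} (c : ColaxCone f L) : Prop where
  existsUnique_fac : ∀ {X : 𝔸.Obj} (d : ColaxCone f X), ∃! t : X ⟶ L, c.precomp t = d
  existsUnique_cell : ∀ {X : 𝔸.Obj} (t t' : X ⟶ L) (θr : t ≫ c.r ⟶ t' ≫ c.r)
    (θs : t ≫ c.s ⟶ t' ≫ c.s), (c.precomp t).Compatible (c.precomp t') θr θs →
    ∃! φ : t ⟶ t', φ ▷ c.r = θr ∧ φ ▷ c.s = θs
  detectsTight : 𝔸.DetectsTight c.r c.s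

/-- The pseudo-cone `c` exhibits `L` as the pseudolimit of the loose morphism `f`. -/
structure IsPseudoLimit {A B : 𝔸.Obj} {f : A ⟶ B} {L : 𝔸.Obj} (c : ColaxCone f L) : Prop where
  isIso : IsIso c.α
  existsUnique_fac : ∀ {X : 𝔸.Obj} (d : ColaxCone f X), IsIso d.α → ∃! t : X ⟶ L, c.precomp t = d
  existsUnique_cell : ∀ {X : 𝔸.Obj} (t t' : X ⟶ L) (θr : t ≫ c.r ⟶ t' ≫ c.r)
    (θs : t ≫ c.s ⟶ t' ≫ c.s), (c.precomp t).Compatible (c.precomp t') θr θs →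
    ∃! φ : t ⟶ t', φ ▷ c.r = θr ∧ φ ▷ c.s = θs
  detectsTight : 𝔸.DetectsTight c.r c.s

/-- The lax cone `c` exhibits `L` as the lax limit of the loose morphism `f`. -/
structure IsLaxLimit {A B : 𝔸.Obj} {f : A ⟶ B} {L : 𝔸.Obj} (c : LaxCone f L) : Prop where
  existsUnique_fac : ∀ {X : 𝔸.Obj} (d : LaxCone f X), ∃! t : X ⟶ L, c.precomp t = d
  existsUnique_cell : ∀ {X : 𝔸.Obj} (t t' : X ⟶ L) (θr : t ≫ c.r ⟶ t' ≫ c.r)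
    (θs : t ≫ c.s ⟶ t' ≫ c.s), (c.precomp t).Compatible (c.precomp t') θr θs →
    ∃! φ : t ⟶ t', φ ▷ c.r = θr ∧ φ ▷ c.s = θs
  detectsTight : 𝔸.DetectsTight c.r c.s

/-- `𝔸` admits `w̄`-limits of loose morphisms: colax limits for `w` lax, pseudolimits for `w`
pseudo and lax limits for `w` colax. -/
def HasBarLimits : Weakness → Prop
  | .lax => ∀ {A B : 𝔸.Obj} (f : A ⟶ B), ∃ (L : 𝔸.Obj) (c : ColaxCone f L), 𝔸.IsColaxLimit c
  | .pseudo => ∀ {A B : 𝔸.Obj} (f : A ⟶ B), ∃ (L : 𝔸.Obj) (c : ColaxCone f L), 𝔸.IsPseudoLimit c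
  | .colax => ∀ {A B : 𝔸.Obj} (f : A ⟶ B), ∃ (L : 𝔸.Obj) (c : LaxCone f L), 𝔸.IsLaxLimit c

end FCategory

/-- A 2-natural transformation between 2-functors. -/
structure TwoNatTrans {B : Type u₁} [Bicategory.{w₁, v₁} B] {C : Type u₂} [Bicategory.{w₂, v₂} C]
    (F G : StrictPseudofunctor B C) where
  app : ∀ X : B, F.obj X ⟶ G.obj X
  naturality : ∀ {X Y : B} (f : X ⟶ Y), F.map f ≫ app Y = app X ≫ G.map f
  naturality₂ : ∀ {X Y : B} {f g : X ⟶ Y} (α : f ⟶ g),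
    F.map₂ α ▷ app Y ≫ eqToHom (naturality g) = eqToHom (naturality f) ≫ app X ◁ G.map₂ α

/-- A 2-adjunction `F ⊣ G` between 2-functors. -/
structure TwoAdjunction {B : Type u₁} [Bicategory.{w₁, v₁} B] {C : Type u₂}
    [Bicategory.{w₂, v₂} C] (F : StrictPseudofunctor B C) (G : StrictPseudofunctor C B) where
  unit : TwoNatTrans (StrictPseudofunctor.id B) (F.comp G)
  counit : TwoNatTrans (G.comp F) (StrictPseudofunctor.id C)
  left_triangle : ∀ X : B, F.map (unit.app X) ≫ counit.app (F.obj X) = 𝟙 (F.obj X)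
  right_triangle : ∀ Y : C, unit.app (G.obj Y) ≫ G.map (counit.app Y) = 𝟙 (G.obj Y)

/-- A 2-monad on a 2-category. -/
structure TwoMonad (C : Type u) [Bicategory.{w, v} C] where
  T : StrictPseudofunctor C C
  η : TwoNatTrans (StrictPseudofunctor.id C) T
  μ : TwoNatTrans (T.comp T) T
  left_unit : ∀ X : C, η.app (T.obj X) ≫ μ.app X = 𝟙 (T.obj X)
  right_unit : ∀ X : C, T.map (η.app X) ≫ μ.app X = 𝟙 (T.obj X)
  assoc : ∀ X : C, T.map (μ.app X) ≫ μ.app X = μ.app (T.obj X) ≫ μ.app X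

/-- The 2-monad `(G F, η, G ε F)` induced by a 2-adjunction `F ⊣ G`. -/
def TwoAdjunction.monad {B : Type u₁} [Bicategory.{w₁, v₁} B] {C : Type u₂}
    [Bicategory.{w₂, v₂} C] {F : StrictPseudofunctor B C} {G : StrictPseudofunctor C B}
    (adj : TwoAdjunction F G) : TwoMonad B where
  T := F.comp G
  η := adj.unit
  μ :=
    { app X := G.map (adj.counit.app (F.obj X))
      naturality f := (G.map_comp _ _).symm.trans
        ((congrArg (fun k => G.map k) (adj.counit.naturality (F.map f))).trans (G.map_comp _ _))
      naturality₂ α := G.map₂_square (adj.counit.naturality₂ (F.map₂ α)) _ _ }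
  left_unit X := adj.right_triangle (F.obj X)
  right_unit X := (G.map_comp _ _).symm.trans
    ((congrArg (fun k => G.map k) (adj.left_triangle X)).trans (G.map_id _))
  assoc X := (G.map_comp _ _).symm.trans
    ((congrArg (fun k => G.map k) (adj.counit.naturality (adj.counit.app (F.obj X)))).trans
      (G.map_comp _ _))

namespace TwoMonad

variable {C : Type u} [Bicategory.{w, v} C] (M : TwoMonad C)

/-- The component `X ⟶ T X` of the unit. -/
def one (X : C) : X ⟶ M.T.obj X := M.η.app X

/-- The component `T T X ⟶ T X` of the multiplication. -/
def mul (X : C) : M.T.obj (M.T.obj X) ⟶ M.T.obj X := M.μ.app X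

theorem one_naturality {X Y : C} (f : X ⟶ Y) : f ≫ M.one Y = M.one X ≫ M.T.map f :=
  M.η.naturality f

theorem mul_naturality {X Y : C} (f : X ⟶ Y) :
    M.T.map (M.T.map f) ≫ M.mul Y = M.mul X ≫ M.T.map f :=
  M.μ.naturality f

theorem one_naturality₂ {X Y : C} {f g : X ⟶ Y} (α : f ⟶ g) :
    α ▷ M.one Y ≫ eqToHom (M.one_naturality g) =
      eqToHom (M.one_naturality f) ≫ M.one X ◁ M.T.map₂ α :=
  M.η.naturality₂ α

theorem mul_naturality₂ {X Y : C} {f g : X ⟶ Y} (α : f ⟶ g) :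
    M.T.map₂ (M.T.map₂ α) ▷ M.mul Y ≫ eqToHom (M.mul_naturality g) =
      eqToHom (M.mul_naturality f) ≫ M.mul X ◁ M.T.map₂ α :=
  M.μ.naturality₂ α

/-- A (strict) algebra for a 2-monad. -/
structure Algebra where
  carrier : C
  str : M.T.obj carrier ⟶ carrier
  unit : M.one carrier ≫ str = 𝟙 carrier
  assoc : M.mul carrier ≫ str = M.T.map str ≫ str

variable {M} [Bicategory.Strict C]

theorem Algebra.one_comp {X Y : M.Algebra} (f : X.carrier ⟶ Y.carrier) :
    M.one X.carrier ≫ M.T.map f ≫ Y.str = f := by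
  rw [← Bicategory.Strict.assoc, ← M.one_naturality, Bicategory.Strict.assoc, Y.unit,
    Bicategory.Strict.comp_id]

theorem Algebra.one_str_comp {X Y : M.Algebra} (f : X.carrier ⟶ Y.carrier) :
    M.one X.carrier ≫ X.str ≫ f = f := by
  rw [← Bicategory.Strict.assoc, X.unit, Bicategory.Strict.id_comp]

theorem Algebra.mul_map_comp {X Y : M.Algebra} (f : X.carrier ⟶ Y.carrier) :
    M.mul X.carrier ≫ M.T.map f ≫ Y.str = M.T.map (M.T.map f ≫ Y.str) ≫ Y.str := by
  rw [← Bicategory.Strict.assoc, ← M.mul_naturality, Bicategory.Strict.assoc, Y.assoc,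
    M.T.map_comp, Bicategory.Strict.assoc]

theorem Algebra.map_str_comp {X Y : M.Algebra} (f : X.carrier ⟶ Y.carrier) :
    M.T.map (X.str ≫ f) ≫ Y.str = M.T.map X.str ≫ M.T.map f ≫ Y.str := by
  rw [M.T.map_comp, Bicategory.Strict.assoc]

theorem Algebra.mul_str_comp {X Y : M.Algebra} (f : X.carrier ⟶ Y.carrier) :
    M.T.map X.str ≫ X.str ≫ f = M.mul X.carrier ≫ X.str ≫ f := by
  rw [← Bicategory.Strict.assoc, ← Bicategory.Strict.assoc, X.assoc]

/-- A lax morphism of algebras: a 1-cell `f` with a 2-cell `b ∘ T f ⇒ f ∘ a` compatible with the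
unit and the multiplication. -/
structure LaxMor (X Y : M.Algebra) where
  hom : X.carrier ⟶ Y.carrier
  cell : M.T.map hom ≫ Y.str ⟶ X.str ≫ hom
  unit : M.one X.carrier ◁ cell =
    eqToHom ((Algebra.one_comp hom).trans (Algebra.one_str_comp hom).symm)
  mult : M.mul X.carrier ◁ cell =
    eqToHom (Algebra.mul_map_comp hom) ≫ M.T.map₂ cell ▷ Y.str ≫
      eqToHom (Algebra.map_str_comp hom) ≫ M.T.map X.str ◁ cell ≫
      eqToHom (Algebra.mul_str_comp hom)

/-- A 2-cell of lax morphisms of algebras. -/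
@[ext]
structure LaxMor₂ {X Y : M.Algebra} (f g : LaxMor X Y) where
  hom : f.hom ⟶ g.hom
  comm : f.cell ≫ X.str ◁ hom = M.T.map₂ hom ▷ Y.str ≫ g.cell

/-- A colax morphism of algebras: a 1-cell `f` with a 2-cell `f ∘ a ⇒ b ∘ T f` compatible with
the unit and the multiplication. -/
structure ColaxMor (X Y : M.Algebra) where
  hom : X.carrier ⟶ Y.carrier
  cell : X.str ≫ hom ⟶ M.T.map hom ≫ Y.str
  unit : M.one X.carrier ◁ cell =
    eqToHom ((Algebra.one_str_comp hom).trans (Algebra.one_comp hom).symm)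
  mult : M.mul X.carrier ◁ cell =
    eqToHom (Algebra.mul_str_comp hom).symm ≫ M.T.map X.str ◁ cell ≫
      eqToHom (Algebra.map_str_comp hom).symm ≫ M.T.map₂ cell ▷ Y.str ≫
      eqToHom (Algebra.mul_map_comp hom).symm

/-- A 2-cell of colax morphisms of algebras. -/
@[ext]
structure ColaxMor₂ {X Y : M.Algebra} (f g : ColaxMor X Y) where
  hom : f.hom ⟶ g.hom
  comm : f.cell ≫ M.T.map₂ hom ▷ Y.str = X.str ◁ hom ≫ g.cell

/-- A strict morphism of algebras. -/
@[ext]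
structure StrictMor (X Y : M.Algebra) where
  hom : X.carrier ⟶ Y.carrier
  comm : M.T.map hom ≫ Y.str = X.str ≫ hom

/-- A 2-cell of strict morphisms of algebras. -/
@[ext]
structure StrictMor₂ {X Y : M.Algebra} (f g : StrictMor X Y) where
  hom : f.hom ⟶ g.hom
  comm : M.T.map₂ hom ▷ Y.str ≫ eqToHom g.comm = eqToHom f.comm ≫ X.str ◁ hom

namespace LaxMor

/-- The identity 2-cell of an identity morphism. -/
def idCell (X : M.Algebra) : M.T.map (𝟙 X.carrier) ≫ X.str ⟶ X.str ≫ (𝟙 X.carrier) :=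
  eqToHom (by rw [M.T.map_id, Bicategory.Strict.id_comp, Bicategory.Strict.comp_id])

/-- The 2-cell of a composite, obtained by pasting the 2-cells of its factors. -/
def compCell {X Y Z : M.Algebra} {f : X.carrier ⟶ Y.carrier} {g : Y.carrier ⟶ Z.carrier}
    (cf : M.T.map f ≫ Y.str ⟶ X.str ≫ f) (cg : M.T.map g ≫ Z.str ⟶ Y.str ≫ g) :
    M.T.map (f ≫ g) ≫ Z.str ⟶ X.str ≫ (f ≫ g) :=
  eqToHom (by rw [M.T.map_comp, Bicategory.Strict.assoc]) ≫ M.T.map f ◁ cg ≫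
    eqToHom (Bicategory.Strict.assoc _ _ _).symm ≫ cf ▷ g ≫
    eqToHom (Bicategory.Strict.assoc _ _ _)

theorem idCell_compCell {X Y : M.Algebra} {f : X.carrier ⟶ Y.carrier}
    (cf : M.T.map f ≫ Y.str ⟶ X.str ≫ f) :
    compCell (idCell X) cf = eqToHom (by rw [Bicategory.Strict.id_comp]) ≫ cf ≫
      eqToHom (by rw [Bicategory.Strict.id_comp]) := by
  simp only [compCell, idCell]
  rw [whiskerLeft_of_eq (M.T.map_id X.carrier)]
  simp [Strict.leftUnitor_eqToIso]

theorem compCell_idCell {X Y : M.Algebra} {f : X.carrier ⟶ Y.carrier}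
    (cf : M.T.map f ≫ Y.str ⟶ X.str ≫ f) :
    compCell cf (idCell Y) = eqToHom (by rw [Bicategory.Strict.comp_id]) ≫ cf ≫
      eqToHom (by rw [Bicategory.Strict.comp_id]) := by
  simp [compCell, idCell, Strict.rightUnitor_eqToIso]

theorem compCell_assoc {X Y Z W : M.Algebra} {f : X.carrier ⟶ Y.carrier}
    {g : Y.carrier ⟶ Z.carrier} {h : Z.carrier ⟶ W.carrier} (cf : M.T.map f ≫ Y.str ⟶ X.str ≫ f)
    (cg : M.T.map g ≫ Z.str ⟶ Y.str ≫ g) (ch : M.T.map h ≫ W.str ⟶ Z.str ≫ h) :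
    compCell (compCell cf cg) ch = eqToHom (by rw [Bicategory.Strict.assoc]) ≫
      compCell cf (compCell cg ch) ≫ eqToHom (by rw [Bicategory.Strict.assoc]) := by
  simp only [compCell]
  rw [whiskerLeft_of_eq (M.T.map_comp f g)]
  simp [Strict.associator_eqToIso]

/-- The identity morphism. -/
def id (X : M.Algebra) : LaxMor X X where
  hom := 𝟙 X.carrier
  cell := idCell X
  unit := by simp [idCell]
  mult := by simp [idCell, PrelaxFunctor.map₂_eqToHom]

/-- Composition of morphisms. -/
def comp {X Y Z : M.Algebra} (f : LaxMor X Y) (g : LaxMor Y Z) : LaxMor X Z where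
  hom := f.hom ≫ g.hom
  cell := compCell f.cell g.cell
  unit := by
    simp only [compCell, whiskerLeft_comp, whiskerLeft_eqToHom]
    rw [Strict.whiskerLeft_whiskerLeft, whiskerLeft_of_eq (M.one_naturality f.hom).symm,
      Strict.whiskerLeft_whiskerRight, f.unit, comp_whiskerLeft, g.unit]
    simp [Strict.associator_eqToIso]
  mult := by
    have e : M.T.map (M.T.map f.hom ≫ Y.str) =
      M.T.map (M.T.map f.hom) ≫ M.T.map Y.str := M.T.map_comp _ _
    have e' := M.T.map_comp X.str f.hom
    have key : (M.T.map (M.T.map f.hom) ≫ M.T.map Y.str) ◁ g.cell ≫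
        eqToHom (by rw [e]) ≫ M.T.map₂ f.cell ▷ (Y.str ≫ g.hom) =
        eqToHom (by rw [e]) ≫ M.T.map₂ f.cell ▷ (M.T.map g.hom ≫ Z.str) ≫ eqToHom (by rw [e']) ≫
          (M.T.map X.str ≫ M.T.map f.hom) ◁ g.cell ≫ eqToHom (by rw [e']) := by
      have h := whisker_exchange (eqToHom e.symm ≫ M.T.map₂ f.cell ≫ eqToHom e') g.cell
      simp only [comp_whiskerRight, eqToHom_whiskerRight, Category.assoc] at h
      rw [← cancel_mono (eqToHom (congrArg (fun k => k ≫ Y.str ≫ g.hom) e'))]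
      simpa only [Category.assoc, eqToHom_trans, eqToHom_refl, Category.comp_id] using h
    simp only [compCell, whiskerLeft_comp, whiskerLeft_eqToHom]
    rw [Strict.whiskerLeft_whiskerLeft, whiskerLeft_of_eq (M.mul_naturality f.hom).symm,
      Strict.whiskerLeft_whiskerRight, f.mult, comp_whiskerLeft, g.mult]
    simp only [PrelaxFunctor.map₂_comp, PrelaxFunctor.map₂_eqToHom,
      StrictPseudofunctor.map₂_whiskerLeft_eqToHom,
      StrictPseudofunctor.map₂_whiskerRight_eqToHom, comp_whiskerRight, whiskerLeft_comp,
      Strict.whiskerLeft_whiskerRight, Strict.whiskerRight_whiskerRight,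
      Strict.whiskerLeft_whiskerLeft,
      eqToHom_whiskerRight, whiskerLeft_eqToHom, Category.assoc, eqToHom_trans_assoc, eqToHom_trans,
      Strict.associator_eqToIso, eqToIso.hom, eqToIso.inv]
    rw [reassoc_of% key]
    simp only [eqToHom_trans_assoc]

theorem eq_of_cell {X Y : M.Algebra} {F G : LaxMor X Y} {f g : X.carrier ⟶ Y.carrier}
    (h : f = g) (hF : F.hom = f) (hG : G.hom = g) {cf : M.T.map f ≫ Y.str ⟶ X.str ≫ f}
    {cg : M.T.map g ≫ Y.str ⟶ X.str ≫ g} (hcF : F.cell ≍ cf) (hcG : G.cell ≍ cg)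
    (hc : cf = eqToHom (by rw [h]) ≫ cg ≫ eqToHom (by rw [h])) : F = G := by
  subst h
  obtain ⟨F, cF, _, _⟩ := F
  obtain ⟨G, cG, _, _⟩ := G
  obtain rfl : F = f := hF
  obtain rfl : G = F := hG
  obtain rfl : cF = cf := eq_of_heq hcF
  obtain rfl : cG = cF := (eq_of_heq hcG).trans (by simpa using hc.symm)
  rfl

theorem id_comp {X Y : M.Algebra} (f : LaxMor X Y) : (id X).comp f = f :=
  eq_of_cell (Bicategory.Strict.id_comp f.hom) rfl rfl .rfl .rfl (idCell_compCell f.cell)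

theorem comp_id {X Y : M.Algebra} (f : LaxMor X Y) : f.comp (id Y) = f :=
  eq_of_cell (Bicategory.Strict.comp_id f.hom) rfl rfl .rfl .rfl (compCell_idCell f.cell)

theorem assoc {X Y Z W : M.Algebra} (f : LaxMor X Y) (g : LaxMor Y Z) (h : LaxMor Z W) :
    (f.comp g).comp h = f.comp (g.comp h) :=
  eq_of_cell (Bicategory.Strict.assoc f.hom g.hom h.hom) rfl rfl .rfl .rfl
    (compCell_assoc f.cell g.cell h.cell)

/-- A lax morphism is strict when its 2-cell is an identity. -/
def IsStrict {X Y : M.Algebra} (f : LaxMor X Y) : Prop :=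
  ∃ h : M.T.map f.hom ≫ Y.str = X.str ≫ f.hom, f.cell = eqToHom h

end LaxMor

namespace ColaxMor

/-- The identity 2-cell of an identity morphism. -/
def idCell (X : M.Algebra) : X.str ≫ (𝟙 X.carrier) ⟶ M.T.map (𝟙 X.carrier) ≫ X.str :=
  eqToHom (by rw [M.T.map_id, Bicategory.Strict.id_comp, Bicategory.Strict.comp_id])

/-- The 2-cell of a composite, obtained by pasting the 2-cells of its factors. -/
def compCell {X Y Z : M.Algebra} {f : X.carrier ⟶ Y.carrier} {g : Y.carrier ⟶ Z.carrier}
    (cf : X.str ≫ f ⟶ M.T.map f ≫ Y.str) (cg : Y.str ≫ g ⟶ M.T.map g ≫ Z.str) :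
    X.str ≫ (f ≫ g) ⟶ M.T.map (f ≫ g) ≫ Z.str :=
  eqToHom (Bicategory.Strict.assoc _ _ _).symm ≫ cf ▷ g ≫
    eqToHom (Bicategory.Strict.assoc _ _ _) ≫ M.T.map f ◁ cg ≫
    eqToHom (by rw [M.T.map_comp, Bicategory.Strict.assoc])

theorem idCell_compCell {X Y : M.Algebra} {f : X.carrier ⟶ Y.carrier}
    (cf : X.str ≫ f ⟶ M.T.map f ≫ Y.str) :
    compCell (idCell X) cf = eqToHom (by rw [Bicategory.Strict.id_comp]) ≫ cf ≫
      eqToHom (by rw [Bicategory.Strict.id_comp]) := by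
  simp only [compCell, idCell]
  rw [whiskerLeft_of_eq (M.T.map_id X.carrier)]
  simp [Strict.leftUnitor_eqToIso]

theorem compCell_idCell {X Y : M.Algebra} {f : X.carrier ⟶ Y.carrier}
    (cf : X.str ≫ f ⟶ M.T.map f ≫ Y.str) :
    compCell cf (idCell Y) = eqToHom (by rw [Bicategory.Strict.comp_id]) ≫ cf ≫
      eqToHom (by rw [Bicategory.Strict.comp_id]) := by
  simp [compCell, idCell, Strict.rightUnitor_eqToIso]

theorem compCell_assoc {X Y Z W : M.Algebra} {f : X.carrier ⟶ Y.carrier}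
    {g : Y.carrier ⟶ Z.carrier} {h : Z.carrier ⟶ W.carrier} (cf : X.str ≫ f ⟶ M.T.map f ≫ Y.str)
    (cg : Y.str ≫ g ⟶ M.T.map g ≫ Z.str) (ch : Z.str ≫ h ⟶ M.T.map h ≫ W.str) :
    compCell (compCell cf cg) ch = eqToHom (by rw [Bicategory.Strict.assoc]) ≫
      compCell cf (compCell cg ch) ≫ eqToHom (by rw [Bicategory.Strict.assoc]) := by
  simp only [compCell]
  rw [whiskerLeft_of_eq (M.T.map_comp f g)]
  simp [Strict.associator_eqToIso]

/-- The identity morphism. -/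
def id (X : M.Algebra) : ColaxMor X X where
  hom := 𝟙 X.carrier
  cell := idCell X
  unit := by simp [idCell]
  mult := by simp [idCell, PrelaxFunctor.map₂_eqToHom]

/-- Composition of morphisms. -/
def comp {X Y Z : M.Algebra} (f : ColaxMor X Y) (g : ColaxMor Y Z) : ColaxMor X Z where
  hom := f.hom ≫ g.hom
  cell := compCell f.cell g.cell
  unit := by
    simp only [compCell, whiskerLeft_comp, whiskerLeft_eqToHom]
    rw [Strict.whiskerLeft_whiskerLeft, whiskerLeft_of_eq (M.one_naturality f.hom).symm,
      Strict.whiskerLeft_whiskerRight, f.unit, comp_whiskerLeft, g.unit]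
    simp [Strict.associator_eqToIso]
  mult := by
    have e : M.T.map (M.T.map f.hom ≫ Y.str) =
      M.T.map (M.T.map f.hom) ≫ M.T.map Y.str := M.T.map_comp _ _
    have e' := M.T.map_comp X.str f.hom
    have key : M.T.map₂ f.cell ▷ (Y.str ≫ g.hom) ≫ eqToHom (by rw [e]) ≫
        (M.T.map (M.T.map f.hom) ≫ M.T.map Y.str) ◁ g.cell =
        eqToHom (by rw [e']) ≫ (M.T.map X.str ≫ M.T.map f.hom) ◁ g.cell ≫ eqToHom (by rw [e']) ≫
          M.T.map₂ f.cell ▷ (M.T.map g.hom ≫ Z.str) ≫ eqToHom (by rw [e]) := by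
      have h := whisker_exchange (eqToHom e'.symm ≫ M.T.map₂ f.cell ≫ eqToHom e) g.cell
      simp only [comp_whiskerRight, eqToHom_whiskerRight, Category.assoc] at h
      rw [← cancel_epi (eqToHom (congrArg (fun k => k ≫ Y.str ≫ g.hom) e').symm)]
      simpa only [eqToHom_trans_assoc, eqToHom_refl, Category.id_comp] using h.symm
    simp only [compCell, whiskerLeft_comp, whiskerLeft_eqToHom]
    rw [Strict.whiskerLeft_whiskerLeft, whiskerLeft_of_eq (M.mul_naturality f.hom).symm,
      Strict.whiskerLeft_whiskerRight, f.mult, comp_whiskerLeft, g.mult]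
    simp only [PrelaxFunctor.map₂_comp, PrelaxFunctor.map₂_eqToHom,
      StrictPseudofunctor.map₂_whiskerLeft_eqToHom,
      StrictPseudofunctor.map₂_whiskerRight_eqToHom, comp_whiskerRight, whiskerLeft_comp,
      Strict.whiskerLeft_whiskerRight, Strict.whiskerRight_whiskerRight,
      Strict.whiskerLeft_whiskerLeft,
      eqToHom_whiskerRight, whiskerLeft_eqToHom, Category.assoc, eqToHom_trans_assoc, eqToHom_trans,
      Strict.associator_eqToIso, eqToIso.hom, eqToIso.inv]
    rw [reassoc_of% key]
    simp only [eqToHom_trans_assoc]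

theorem eq_of_cell {X Y : M.Algebra} {F G : ColaxMor X Y} {f g : X.carrier ⟶ Y.carrier}
    (h : f = g) (hF : F.hom = f) (hG : G.hom = g) {cf : X.str ≫ f ⟶ M.T.map f ≫ Y.str}
    {cg : X.str ≫ g ⟶ M.T.map g ≫ Y.str} (hcF : F.cell ≍ cf) (hcG : G.cell ≍ cg)
    (hc : cf = eqToHom (by rw [h]) ≫ cg ≫ eqToHom (by rw [h])) : F = G := by
  subst h
  obtain ⟨F, cF, _, _⟩ := F
  obtain ⟨G, cG, _, _⟩ := G
  obtain rfl : F = f := hF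
  obtain rfl : G = F := hG
  obtain rfl : cF = cf := eq_of_heq hcF
  obtain rfl : cG = cF := (eq_of_heq hcG).trans (by simpa using hc.symm)
  rfl

theorem id_comp {X Y : M.Algebra} (f : ColaxMor X Y) : (id X).comp f = f :=
  eq_of_cell (Bicategory.Strict.id_comp f.hom) rfl rfl .rfl .rfl (idCell_compCell f.cell)

theorem comp_id {X Y : M.Algebra} (f : ColaxMor X Y) : f.comp (id Y) = f :=
  eq_of_cell (Bicategory.Strict.comp_id f.hom) rfl rfl .rfl .rfl (compCell_idCell f.cell)

theorem assoc {X Y Z W : M.Algebra} (f : ColaxMor X Y) (g : ColaxMor Y Z) (h : ColaxMor Z W) :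
    (f.comp g).comp h = f.comp (g.comp h) :=
  eq_of_cell (Bicategory.Strict.assoc f.hom g.hom h.hom) rfl rfl .rfl .rfl
    (compCell_assoc f.cell g.cell h.cell)

/-- A colax morphism is strict when its 2-cell is an identity. -/
def IsStrict {X Y : M.Algebra} (f : ColaxMor X Y) : Prop :=
  ∃ h : X.str ≫ f.hom = M.T.map f.hom ≫ Y.str, f.cell = eqToHom h

end ColaxMor

namespace LaxMor

theorem compCell_whiskerLeft {X Y Z : M.Algebra} {f : X.carrier ⟶ Y.carrier}
    {g g' : Y.carrier ⟶ Z.carrier} (cf : M.T.map f ≫ Y.str ⟶ X.str ≫ f) (cg : M.T.map g ≫ Z.str ⟶ Y.str ≫ g)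
    (cg' : M.T.map g' ≫ Z.str ⟶ Y.str ≫ g') {β : g ⟶ g'}
    (h : cg ≫ Y.str ◁ β = M.T.map₂ β ▷ Z.str ≫ cg') :
    compCell cf cg ≫ X.str ◁ (f ◁ β) = M.T.map₂ (f ◁ β) ▷ Z.str ≫ compCell cf cg' := by
  have k : cf ▷ g ≫ eqToHom (Bicategory.Strict.assoc _ _ _) ≫ X.str ◁ f ◁ β =
      eqToHom (Bicategory.Strict.assoc _ _ _) ≫ M.T.map f ◁ Y.str ◁ β ≫
        eqToHom (Bicategory.Strict.assoc _ _ _).symm ≫ cf ▷ g' ≫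
        eqToHom (Bicategory.Strict.assoc _ _ _) := by
    have h' := whisker_exchange cf β
    simp only [comp_whiskerLeft, Strict.associator_eqToIso, eqToIso.hom, eqToIso.inv,
      Category.assoc] at h'
    rw [reassoc_of% h']
    simp
  have h' := congrArg (fun x => M.T.map f ◁ x) h
  simp only [whiskerLeft_comp] at h'
  simp only [compCell, StrictPseudofunctor.map₂_whiskerLeft_eqToHom, comp_whiskerRight,
    eqToHom_whiskerRight, whisker_assoc, Category.assoc, eqToHom_trans_assoc,
    Strict.associator_eqToIso, eqToIso.hom, eqToIso.inv]
  rw [k]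
  simp only [eqToHom_trans_assoc, eqToHom_refl, Category.id_comp]
  rw [reassoc_of% h']

theorem compCell_whiskerRight {X Y Z : M.Algebra} {f f' : X.carrier ⟶ Y.carrier}
    {g : Y.carrier ⟶ Z.carrier} (cf : M.T.map f ≫ Y.str ⟶ X.str ≫ f) (cf' : M.T.map f' ≫ Y.str ⟶ X.str ≫ f')
    (cg : M.T.map g ≫ Z.str ⟶ Y.str ≫ g) {α : f ⟶ f'}
    (h : cf ≫ X.str ◁ α = M.T.map₂ α ▷ Y.str ≫ cf') :
    compCell cf cg ≫ X.str ◁ (α ▷ g) = M.T.map₂ (α ▷ g) ▷ Z.str ≫ compCell cf' cg := by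
  have k : M.T.map f ◁ cg ≫ eqToHom (Bicategory.Strict.assoc _ _ _).symm ≫
      M.T.map₂ α ▷ Y.str ▷ g =
      eqToHom (Bicategory.Strict.assoc _ _ _).symm ≫ M.T.map₂ α ▷ M.T.map g ▷ Z.str ≫
        eqToHom (Bicategory.Strict.assoc _ _ _) ≫ M.T.map f' ◁ cg ≫
        eqToHom (Bicategory.Strict.assoc _ _ _).symm := by
    have h' := whisker_exchange (M.T.map₂ α) cg
    simp only [whiskerRight_comp, Strict.associator_eqToIso, eqToIso.hom, eqToIso.inv,
      Category.assoc] at h'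
    rw [← cancel_mono (eqToHom (Bicategory.Strict.assoc (M.T.map f') Y.str g))]
    simpa using h'
  have h' : cf ▷ g ≫ eqToHom (Bicategory.Strict.assoc _ _ _) ≫ X.str ◁ α ▷ g =
      M.T.map₂ α ▷ Y.str ▷ g ≫ cf' ▷ g ≫ eqToHom (Bicategory.Strict.assoc _ _ _) := by
    have h' := congrArg (fun x => x ▷ g) h
    simp only [comp_whiskerRight, whisker_assoc, Strict.associator_eqToIso, eqToIso.hom,
      eqToIso.inv] at h'
    rw [← reassoc_of% h']
    simp
  simp only [compCell, StrictPseudofunctor.map₂_whiskerRight_eqToHom, comp_whiskerRight,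
    eqToHom_whiskerRight, Category.assoc, eqToHom_trans_assoc]
  rw [h', reassoc_of% k]
  simp

end LaxMor

/-- The objects of the 2-category of algebras and lax morphisms. -/
@[ext]
structure LaxAlg (M : TwoMonad C) where
  alg : M.Algebra

namespace LaxAlg

instance : CategoryStruct (M.LaxAlg) where
  Hom X Y := LaxMor X.alg Y.alg
  id X := LaxMor.id X.alg
  comp f g := LaxMor.comp f g

instance (X Y : M.LaxAlg) : Category (X ⟶ Y) where
  Hom f g := LaxMor₂ f g
  id f := ⟨𝟙 f.hom, by simp⟩
  comp α β := ⟨α.hom ≫ β.hom, by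
    have h₁ := α.comm
    have h₂ := β.comm
    simp only [whiskerLeft_comp, PrelaxFunctor.map₂_comp, comp_whiskerRight, Category.assoc]
    rw [reassoc_of% h₁, h₂]⟩
  id_comp α := LaxMor₂.ext (Category.id_comp α.hom)
  comp_id α := LaxMor₂.ext (Category.comp_id α.hom)
  assoc α β γ := LaxMor₂.ext (Category.assoc α.hom β.hom γ.hom)

theorem eqToHom_hom {X Y : M.LaxAlg} {f g : X ⟶ Y} (h : f = g) :
    (eqToHom h).hom = eqToHom (congrArg LaxMor.hom h) := by
  subst h; rfl

theorem conj_hom {X Y : M.LaxAlg} {f f' g g' : X ⟶ Y} (h : f = f') (h' : g' = g)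
    (α : f' ⟶ g') :
    LaxMor₂.hom (eqToHom h ≫ α ≫ eqToHom h') = eqToHom (congrArg LaxMor.hom h) ≫ LaxMor₂.hom α ≫
      eqToHom (congrArg LaxMor.hom h') := by
  subst h h'
  rw [eqToHom_refl, eqToHom_refl, Category.id_comp, Category.comp_id]
  exact eq_eqToHom_conj _ _ _

/-- An equality of morphisms gives an invertible 2-cell over a prescribed identity 2-cell. -/
def isoOfEq {X Y : M.LaxAlg} {f g : X ⟶ Y} (h : f = g) (e : f.hom ≅ g.hom)
    (he : e = eqToIso (congrArg LaxMor.hom h)) : f ≅ g where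
  hom := ⟨e.hom, by subst h he; simp⟩
  inv := ⟨e.inv, by subst h he; simp⟩
  hom_inv_id := LaxMor₂.ext e.hom_inv_id
  inv_hom_id := LaxMor₂.ext e.inv_hom_id

instance : Bicategory (M.LaxAlg) where
  homCategory _ _ := inferInstance
  whiskerLeft f _ _ α := ⟨f.hom ◁ α.hom, LaxMor.compCell_whiskerLeft _ _ _ α.comm⟩
  whiskerRight α h := ⟨α.hom ▷ h.hom, LaxMor.compCell_whiskerRight _ _ _ α.comm⟩
  associator f g h := isoOfEq (LaxMor.assoc f g h) (α_ f.hom g.hom h.hom)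
    (Bicategory.Strict.associator_eqToIso f.hom g.hom h.hom)
  leftUnitor f := isoOfEq (LaxMor.id_comp f) (λ_ f.hom) (Bicategory.Strict.leftUnitor_eqToIso f.hom)
  rightUnitor f := isoOfEq (LaxMor.comp_id f) (ρ_ f.hom)
    (Bicategory.Strict.rightUnitor_eqToIso f.hom)
  whiskerLeft_id f g := LaxMor₂.ext (whiskerLeft_id f.hom g.hom)
  whiskerLeft_comp f _ _ _ α β := LaxMor₂.ext (whiskerLeft_comp f.hom α.hom β.hom)
  id_whiskerLeft α := LaxMor₂.ext (id_whiskerLeft α.hom)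
  comp_whiskerLeft f g _ _ α := LaxMor₂.ext (comp_whiskerLeft f.hom g.hom α.hom)
  id_whiskerRight f g := LaxMor₂.ext (id_whiskerRight f.hom g.hom)
  comp_whiskerRight α β h := LaxMor₂.ext (comp_whiskerRight α.hom β.hom h.hom)
  whiskerRight_id α := LaxMor₂.ext (whiskerRight_id α.hom)
  whiskerRight_comp α g h := LaxMor₂.ext (whiskerRight_comp α.hom g.hom h.hom)
  whisker_assoc f _ _ α h := LaxMor₂.ext (whisker_assoc f.hom α.hom h.hom)
  whisker_exchange α β := LaxMor₂.ext (whisker_exchange α.hom β.hom)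
  pentagon f g h i := LaxMor₂.ext (pentagon f.hom g.hom h.hom i.hom)
  triangle f g := LaxMor₂.ext (triangle f.hom g.hom)

instance : Bicategory.Strict (M.LaxAlg) where
  id_comp f := LaxMor.id_comp f
  comp_id f := LaxMor.comp_id f
  assoc f g h := LaxMor.assoc f g h
  leftUnitor_eqToIso f := Iso.ext (LaxMor₂.ext (by
    rw [eqToIso.hom, eqToHom_hom]
    exact congrArg Iso.hom (Bicategory.Strict.leftUnitor_eqToIso f.hom)))
  rightUnitor_eqToIso f := Iso.ext (LaxMor₂.ext (by
    rw [eqToIso.hom, eqToHom_hom]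
    exact congrArg Iso.hom (Bicategory.Strict.rightUnitor_eqToIso f.hom)))
  associator_eqToIso f g h := Iso.ext (LaxMor₂.ext (by
    rw [eqToIso.hom, eqToHom_hom]
    exact congrArg Iso.hom (Bicategory.Strict.associator_eqToIso f.hom g.hom h.hom)))

end LaxAlg

namespace ColaxMor

theorem compCell_whiskerLeft {X Y Z : M.Algebra} {f : X.carrier ⟶ Y.carrier}
    {g g' : Y.carrier ⟶ Z.carrier} (cf : X.str ≫ f ⟶ M.T.map f ≫ Y.str) (cg : Y.str ≫ g ⟶ M.T.map g ≫ Z.str)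
    (cg' : Y.str ≫ g' ⟶ M.T.map g' ≫ Z.str) {β : g ⟶ g'}
    (h : cg ≫ M.T.map₂ β ▷ Z.str = Y.str ◁ β ≫ cg') :
    compCell cf cg ≫ M.T.map₂ (f ◁ β) ▷ Z.str = X.str ◁ (f ◁ β) ≫ compCell cf cg' := by
  have k : cf ▷ g ≫ eqToHom (Bicategory.Strict.assoc _ _ _) ≫ M.T.map f ◁ Y.str ◁ β =
      eqToHom (Bicategory.Strict.assoc _ _ _) ≫ X.str ◁ f ◁ β ≫
        eqToHom (Bicategory.Strict.assoc _ _ _).symm ≫ cf ▷ g' ≫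
        eqToHom (Bicategory.Strict.assoc _ _ _) := by
    have h' := whisker_exchange cf β
    simp only [comp_whiskerLeft, Strict.associator_eqToIso, eqToIso.hom, eqToIso.inv,
      Category.assoc] at h'
    rw [reassoc_of% h']
    simp
  have h' := congrArg (fun x => M.T.map f ◁ x) h
  simp only [whiskerLeft_comp] at h'
  simp only [compCell, StrictPseudofunctor.map₂_whiskerLeft_eqToHom, comp_whiskerRight,
    eqToHom_whiskerRight, whisker_assoc, Category.assoc, eqToHom_trans_assoc,
    Strict.associator_eqToIso, eqToIso.hom, eqToIso.inv]
  simp only [eqToHom_refl, Category.id_comp]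
  rw [reassoc_of% h', reassoc_of% k]
  simp

theorem compCell_whiskerRight {X Y Z : M.Algebra} {f f' : X.carrier ⟶ Y.carrier}
    {g : Y.carrier ⟶ Z.carrier} (cf : X.str ≫ f ⟶ M.T.map f ≫ Y.str) (cf' : X.str ≫ f' ⟶ M.T.map f' ≫ Y.str)
    (cg : Y.str ≫ g ⟶ M.T.map g ≫ Z.str) {α : f ⟶ f'}
    (h : cf ≫ M.T.map₂ α ▷ Y.str = X.str ◁ α ≫ cf') :
    compCell cf cg ≫ M.T.map₂ (α ▷ g) ▷ Z.str = X.str ◁ (α ▷ g) ≫ compCell cf' cg := by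
  have k : M.T.map f ◁ cg ≫ eqToHom (Bicategory.Strict.assoc _ _ _).symm ≫
      M.T.map₂ α ▷ M.T.map g ▷ Z.str =
      eqToHom (Bicategory.Strict.assoc _ _ _).symm ≫ M.T.map₂ α ▷ Y.str ▷ g ≫
        eqToHom (Bicategory.Strict.assoc _ _ _) ≫ M.T.map f' ◁ cg ≫
        eqToHom (Bicategory.Strict.assoc _ _ _).symm := by
    have h' := whisker_exchange (M.T.map₂ α) cg
    simp only [whiskerRight_comp, Strict.associator_eqToIso, eqToIso.hom, eqToIso.inv,
      Category.assoc] at h'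
    rw [← cancel_mono (eqToHom (Bicategory.Strict.assoc (M.T.map f') (M.T.map g) Z.str))]
    simpa using h'
  have h' : cf ▷ g ≫ M.T.map₂ α ▷ Y.str ▷ g =
      eqToHom (Bicategory.Strict.assoc _ _ _) ≫ X.str ◁ α ▷ g ≫ eqToHom (Bicategory.Strict.assoc _ _ _).symm ≫ cf' ▷ g := by
    have h' := congrArg (fun x => x ▷ g) h
    simp only [comp_whiskerRight, whisker_assoc, Strict.associator_eqToIso, eqToIso.hom,
      eqToIso.inv] at h'
    rw [h']
    simp
  simp only [compCell, StrictPseudofunctor.map₂_whiskerRight_eqToHom, comp_whiskerRight,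
    eqToHom_whiskerRight, Category.assoc, eqToHom_trans_assoc]
  rw [reassoc_of% k]
  simp only [eqToHom_trans_assoc, eqToHom_refl, Category.id_comp]
  rw [reassoc_of% h']
  simp

end ColaxMor

/-- The objects of the 2-category of algebras and colax morphisms. -/
@[ext]
structure ColaxAlg (M : TwoMonad C) where
  alg : M.Algebra

namespace ColaxAlg

instance : CategoryStruct (M.ColaxAlg) where
  Hom X Y := ColaxMor X.alg Y.alg
  id X := ColaxMor.id X.alg
  comp f g := ColaxMor.comp f g

instance (X Y : M.ColaxAlg) : Category (X ⟶ Y) where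
  Hom f g := ColaxMor₂ f g
  id f := ⟨𝟙 f.hom, by simp⟩
  comp α β := ⟨α.hom ≫ β.hom, by
    have h₁ := α.comm
    have h₂ := β.comm
    simp only [whiskerLeft_comp, PrelaxFunctor.map₂_comp, comp_whiskerRight, Category.assoc]
    rw [reassoc_of% h₁, h₂]⟩
  id_comp α := ColaxMor₂.ext (Category.id_comp α.hom)
  comp_id α := ColaxMor₂.ext (Category.comp_id α.hom)
  assoc α β γ := ColaxMor₂.ext (Category.assoc α.hom β.hom γ.hom)

theorem eqToHom_hom {X Y : M.ColaxAlg} {f g : X ⟶ Y} (h : f = g) :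
    (eqToHom h).hom = eqToHom (congrArg ColaxMor.hom h) := by
  subst h; rfl

theorem conj_hom {X Y : M.ColaxAlg} {f f' g g' : X ⟶ Y} (h : f = f') (h' : g' = g)
    (α : f' ⟶ g') :
    ColaxMor₂.hom (eqToHom h ≫ α ≫ eqToHom h') = eqToHom (congrArg ColaxMor.hom h) ≫ ColaxMor₂.hom α ≫
      eqToHom (congrArg ColaxMor.hom h') := by
  subst h h'
  rw [eqToHom_refl, eqToHom_refl, Category.id_comp, Category.comp_id]
  exact eq_eqToHom_conj _ _ _

/-- An equality of morphisms gives an invertible 2-cell over a prescribed identity 2-cell. -/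
def isoOfEq {X Y : M.ColaxAlg} {f g : X ⟶ Y} (h : f = g) (e : f.hom ≅ g.hom)
    (he : e = eqToIso (congrArg ColaxMor.hom h)) : f ≅ g where
  hom := ⟨e.hom, by subst h he; simp⟩
  inv := ⟨e.inv, by subst h he; simp⟩
  hom_inv_id := ColaxMor₂.ext e.hom_inv_id
  inv_hom_id := ColaxMor₂.ext e.inv_hom_id

instance : Bicategory (M.ColaxAlg) where
  homCategory _ _ := inferInstance
  whiskerLeft f _ _ α := ⟨f.hom ◁ α.hom, ColaxMor.compCell_whiskerLeft _ _ _ α.comm⟩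
  whiskerRight α h := ⟨α.hom ▷ h.hom, ColaxMor.compCell_whiskerRight _ _ _ α.comm⟩
  associator f g h := isoOfEq (ColaxMor.assoc f g h) (α_ f.hom g.hom h.hom)
    (Bicategory.Strict.associator_eqToIso f.hom g.hom h.hom)
  leftUnitor f := isoOfEq (ColaxMor.id_comp f) (λ_ f.hom) (Bicategory.Strict.leftUnitor_eqToIso f.hom)
  rightUnitor f := isoOfEq (ColaxMor.comp_id f) (ρ_ f.hom)
    (Bicategory.Strict.rightUnitor_eqToIso f.hom)
  whiskerLeft_id f g := ColaxMor₂.ext (whiskerLeft_id f.hom g.hom)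
  whiskerLeft_comp f _ _ _ α β := ColaxMor₂.ext (whiskerLeft_comp f.hom α.hom β.hom)
  id_whiskerLeft α := ColaxMor₂.ext (id_whiskerLeft α.hom)
  comp_whiskerLeft f g _ _ α := ColaxMor₂.ext (comp_whiskerLeft f.hom g.hom α.hom)
  id_whiskerRight f g := ColaxMor₂.ext (id_whiskerRight f.hom g.hom)
  comp_whiskerRight α β h := ColaxMor₂.ext (comp_whiskerRight α.hom β.hom h.hom)
  whiskerRight_id α := ColaxMor₂.ext (whiskerRight_id α.hom)
  whiskerRight_comp α g h := ColaxMor₂.ext (whiskerRight_comp α.hom g.hom h.hom)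
  whisker_assoc f _ _ α h := ColaxMor₂.ext (whisker_assoc f.hom α.hom h.hom)
  whisker_exchange α β := ColaxMor₂.ext (whisker_exchange α.hom β.hom)
  pentagon f g h i := ColaxMor₂.ext (pentagon f.hom g.hom h.hom i.hom)
  triangle f g := ColaxMor₂.ext (triangle f.hom g.hom)

instance : Bicategory.Strict (M.ColaxAlg) where
  id_comp f := ColaxMor.id_comp f
  comp_id f := ColaxMor.comp_id f
  assoc f g h := ColaxMor.assoc f g h
  leftUnitor_eqToIso f := Iso.ext (ColaxMor₂.ext (by
    rw [eqToIso.hom, eqToHom_hom]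
    exact congrArg Iso.hom (Bicategory.Strict.leftUnitor_eqToIso f.hom)))
  rightUnitor_eqToIso f := Iso.ext (ColaxMor₂.ext (by
    rw [eqToIso.hom, eqToHom_hom]
    exact congrArg Iso.hom (Bicategory.Strict.rightUnitor_eqToIso f.hom)))
  associator_eqToIso f g h := Iso.ext (ColaxMor₂.ext (by
    rw [eqToIso.hom, eqToHom_hom]
    exact congrArg Iso.hom (Bicategory.Strict.associator_eqToIso f.hom g.hom h.hom)))

end ColaxAlg



namespace StrictMor

/-- The identity morphism. -/
def id (X : M.Algebra) : StrictMor X X where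
  hom := 𝟙 X.carrier
  comm := by rw [M.T.map_id, Bicategory.Strict.id_comp, Bicategory.Strict.comp_id]

/-- Composition of morphisms. -/
def comp {X Y Z : M.Algebra} (f : StrictMor X Y) (g : StrictMor Y Z) : StrictMor X Z where
  hom := f.hom ≫ g.hom
  comm := by
    rw [M.T.map_comp, Bicategory.Strict.assoc, g.comm, ← Bicategory.Strict.assoc, f.comm,
      Bicategory.Strict.assoc]

end StrictMor

namespace LaxMor

theorem compCell_eqToHom {X Y Z : M.Algebra} {f : X.carrier ⟶ Y.carrier}
    {g : Y.carrier ⟶ Z.carrier} (hf : M.T.map f ≫ Y.str = X.str ≫ f)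
    (hg : M.T.map g ≫ Z.str = Y.str ≫ g) :
    compCell (eqToHom hf) (eqToHom hg) = eqToHom (by
      rw [M.T.map_comp, Bicategory.Strict.assoc, hg, ← Bicategory.Strict.assoc, hf,
        Bicategory.Strict.assoc]) := by
  simp [compCell]

theorem isStrict_id (X : M.Algebra) : (LaxMor.id X).IsStrict :=
  ⟨(StrictMor.id X).comm, rfl⟩

theorem IsStrict.comp {X Y Z : M.Algebra} {f : LaxMor X Y} {g : LaxMor Y Z} (hf : f.IsStrict)
    (hg : g.IsStrict) : (f.comp g).IsStrict := by
  obtain ⟨hf, ef⟩ := hf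
  obtain ⟨hg, eg⟩ := hg
  refine ⟨(StrictMor.comp ⟨f.hom, hf⟩ ⟨g.hom, hg⟩).comm, ?_⟩
  change compCell f.cell g.cell = _
  rw [ef, eg, compCell_eqToHom]
  rfl

end LaxMor

namespace ColaxMor

theorem compCell_eqToHom {X Y Z : M.Algebra} {f : X.carrier ⟶ Y.carrier}
    {g : Y.carrier ⟶ Z.carrier} (hf : X.str ≫ f = M.T.map f ≫ Y.str)
    (hg : Y.str ≫ g = M.T.map g ≫ Z.str) :
    compCell (eqToHom hf) (eqToHom hg) = eqToHom (by
      rw [M.T.map_comp, Bicategory.Strict.assoc, ← hg, ← Bicategory.Strict.assoc, hf,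
        Bicategory.Strict.assoc]) := by
  simp [compCell]

theorem isStrict_id (X : M.Algebra) : (ColaxMor.id X).IsStrict :=
  ⟨(StrictMor.id X).comm.symm, rfl⟩

theorem IsStrict.comp {X Y Z : M.Algebra} {f : ColaxMor X Y} {g : ColaxMor Y Z} (hf : f.IsStrict)
    (hg : g.IsStrict) : (f.comp g).IsStrict := by
  obtain ⟨hf, ef⟩ := hf
  obtain ⟨hg, eg⟩ := hg
  refine ⟨(StrictMor.comp ⟨f.hom, hf.symm⟩ ⟨g.hom, hg.symm⟩).comm.symm, ?_⟩
  change compCell f.cell g.cell = _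
  rw [ef, eg, compCell_eqToHom]
  rfl

end ColaxMor

/-- The objects of the 2-category of algebras and strict morphisms. -/
@[ext]
structure StrictAlg (M : TwoMonad C) where
  alg : M.Algebra

namespace StrictAlg

instance : CategoryStruct (M.StrictAlg) where
  Hom X Y := StrictMor X.alg Y.alg
  id X := StrictMor.id X.alg
  comp f g := StrictMor.comp f g

instance (X Y : M.StrictAlg) : Category (X ⟶ Y) where
  Hom f g := StrictMor₂ f g
  id f := ⟨𝟙 f.hom, by simp⟩
  comp α β := ⟨α.hom ≫ β.hom, by
    have h₁ := α.comm
    have h₂ := β.comm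
    simp only [whiskerLeft_comp, PrelaxFunctor.map₂_comp, comp_whiskerRight, Category.assoc]
    rw [h₂, reassoc_of% h₁]⟩
  id_comp α := StrictMor₂.ext (Category.id_comp α.hom)
  comp_id α := StrictMor₂.ext (Category.comp_id α.hom)
  assoc α β γ := StrictMor₂.ext (Category.assoc α.hom β.hom γ.hom)

theorem eqToHom_hom {X Y : M.StrictAlg} {f g : X ⟶ Y} (h : f = g) :
    (eqToHom h).hom = eqToHom (congrArg StrictMor.hom h) := by
  subst h; rfl

theorem conj_hom {X Y : M.StrictAlg} {f f' g g' : X ⟶ Y} (h : f = f') (h' : g' = g)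
    (α : f' ⟶ g') :
    StrictMor₂.hom (eqToHom h ≫ α ≫ eqToHom h') = eqToHom (congrArg StrictMor.hom h) ≫
      StrictMor₂.hom α ≫ eqToHom (congrArg StrictMor.hom h') := by
  subst h h'
  rw [eqToHom_refl, eqToHom_refl, Category.id_comp, Category.comp_id]
  exact eq_eqToHom_conj _ _ _

/-- An equality of morphisms gives an invertible 2-cell over a prescribed identity 2-cell. -/
def isoOfEq {X Y : M.StrictAlg} {f g : X ⟶ Y} (h : f = g) (e : f.hom ≅ g.hom)
    (he : e = eqToIso (congrArg StrictMor.hom h)) : f ≅ g where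
  hom := ⟨e.hom, by subst h he; simp⟩
  inv := ⟨e.inv, by subst h he; simp⟩
  hom_inv_id := StrictMor₂.ext e.hom_inv_id
  inv_hom_id := StrictMor₂.ext e.inv_hom_id

instance : Bicategory (M.StrictAlg) where
  homCategory _ _ := inferInstance
  whiskerLeft f g g' α := ⟨f.hom ◁ α.hom, by
    have h := LaxMor.compCell_whiskerLeft (eqToHom f.comm) _ _ α.comm.symm
    rw [LaxMor.compCell_eqToHom, LaxMor.compCell_eqToHom] at h
    exact h.symm⟩
  whiskerRight α h := ⟨α.hom ▷ h.hom, by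
    have h := LaxMor.compCell_whiskerRight _ _ (eqToHom h.comm) α.comm.symm
    rw [LaxMor.compCell_eqToHom, LaxMor.compCell_eqToHom] at h
    exact h.symm⟩
  associator f g h := isoOfEq (StrictMor.ext (Bicategory.Strict.assoc f.hom g.hom h.hom))
    (α_ f.hom g.hom h.hom) (Bicategory.Strict.associator_eqToIso f.hom g.hom h.hom)
  leftUnitor f := isoOfEq (StrictMor.ext (Bicategory.Strict.id_comp f.hom)) (λ_ f.hom)
    (Bicategory.Strict.leftUnitor_eqToIso f.hom)
  rightUnitor f := isoOfEq (StrictMor.ext (Bicategory.Strict.comp_id f.hom)) (ρ_ f.hom)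
    (Bicategory.Strict.rightUnitor_eqToIso f.hom)
  whiskerLeft_id f g := StrictMor₂.ext (whiskerLeft_id f.hom g.hom)
  whiskerLeft_comp f _ _ _ α β := StrictMor₂.ext (whiskerLeft_comp f.hom α.hom β.hom)
  id_whiskerLeft α := StrictMor₂.ext (id_whiskerLeft α.hom)
  comp_whiskerLeft f g _ _ α := StrictMor₂.ext (comp_whiskerLeft f.hom g.hom α.hom)
  id_whiskerRight f g := StrictMor₂.ext (id_whiskerRight f.hom g.hom)
  comp_whiskerRight α β h := StrictMor₂.ext (comp_whiskerRight α.hom β.hom h.hom)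
  whiskerRight_id α := StrictMor₂.ext (whiskerRight_id α.hom)
  whiskerRight_comp α g h := StrictMor₂.ext (whiskerRight_comp α.hom g.hom h.hom)
  whisker_assoc f _ _ α h := StrictMor₂.ext (whisker_assoc f.hom α.hom h.hom)
  whisker_exchange α β := StrictMor₂.ext (whisker_exchange α.hom β.hom)
  pentagon f g h i := StrictMor₂.ext (pentagon f.hom g.hom h.hom i.hom)
  triangle f g := StrictMor₂.ext (triangle f.hom g.hom)

instance : Bicategory.Strict (M.StrictAlg) where
  id_comp f := StrictMor.ext (Bicategory.Strict.id_comp f.hom)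
  comp_id f := StrictMor.ext (Bicategory.Strict.comp_id f.hom)
  assoc f g h := StrictMor.ext (Bicategory.Strict.assoc f.hom g.hom h.hom)
  leftUnitor_eqToIso f := Iso.ext (StrictMor₂.ext (by
    rw [eqToIso.hom, eqToHom_hom]
    exact congrArg Iso.hom (Bicategory.Strict.leftUnitor_eqToIso f.hom)))
  rightUnitor_eqToIso f := Iso.ext (StrictMor₂.ext (by
    rw [eqToIso.hom, eqToHom_hom]
    exact congrArg Iso.hom (Bicategory.Strict.rightUnitor_eqToIso f.hom)))
  associator_eqToIso f g h := Iso.ext (StrictMor₂.ext (by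
    rw [eqToIso.hom, eqToHom_hom]
    exact congrArg Iso.hom (Bicategory.Strict.associator_eqToIso f.hom g.hom h.hom)))

end StrictAlg

variable (M)

/-- The `F`-category of algebras, strict morphisms (tight) and lax morphisms (loose). -/
abbrev laxFCategory : FCategory where
  Obj := M.LaxAlg
  IsTight f := LaxMor.IsStrict f
  isTight_id X := LaxMor.isStrict_id X.alg
  isTight_comp _ _ hf hg := hf.comp hg

/-- The `F`-category of algebras, strict morphisms (tight) and colax morphisms (loose). -/
abbrev colaxFCategory : FCategory where
  Obj := M.ColaxAlg
  IsTight f := ColaxMor.IsStrict f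
  isTight_id X := ColaxMor.isStrict_id X.alg
  isTight_comp _ _ hf hg := hf.comp hg

/-- The `F`-category of algebras, pseudomorphisms (tight) and lax morphisms (loose): a
pseudomorphism is a lax morphism whose 2-cell is invertible. -/
abbrev pseudoLaxFCategory : FCategory where
  Obj := M.LaxAlg
  IsTight f := IsIso (LaxMor.cell f)
  isTight_id X := inferInstanceAs (IsIso (eqToHom (StrictMor.id X.alg).comm))
  isTight_comp f g hf hg := by
    have := hf
    have := hg
    change IsIso (LaxMor.compCell (LaxMor.cell f) (LaxMor.cell g))
    unfold LaxMor.compCell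
    infer_instance

/-- The `F`-category of algebras, strict morphisms (tight) and pseudomorphisms (loose). -/
abbrev pseudoFCategory : FCategory where
  Obj := M.pseudoLaxFCategory.Tight
  IsTight f := LaxMor.IsStrict (FCategory.TightHom.hom f)
  isTight_id X := LaxMor.isStrict_id (LaxAlg.alg X.obj)
  isTight_comp _ _ hf hg := LaxMor.IsStrict.comp hf hg

/-- The `F`-category `T-𝔸lg_w` of algebras, strict morphisms (tight) and `w`-morphisms (loose). -/
abbrev algFCategory : Weakness → FCategory
  | .lax => M.laxFCategory
  | .pseudo => M.pseudoFCategory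
  | .colax => M.colaxFCategory

/-- The forgetful 2-functor from algebras and strict morphisms. -/
def strictForget : StrictPseudofunctor M.StrictAlg C :=
  .mk'' {
    obj X := X.alg.carrier
    map f := StrictMor.hom f
    map₂ α := StrictMor₂.hom α
    map₂_id _ := rfl
    map₂_comp _ _ := rfl
    map_id _ := rfl
    map_comp _ _ := rfl
    map₂_whisker_left _ _ _ _ := eq_eqToHom_conj rfl rfl _
    map₂_whisker_right _ _ := eq_eqToHom_conj rfl rfl _ }

/-- The forgetful 2-functor from algebras and lax morphisms. -/
def laxForget : StrictPseudofunctor M.LaxAlg C :=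
  .mk'' {
    obj X := X.alg.carrier
    map f := LaxMor.hom f
    map₂ α := LaxMor₂.hom α
    map₂_id _ := rfl
    map₂_comp _ _ := rfl
    map_id _ := rfl
    map_comp _ _ := rfl
    map₂_whisker_left _ _ _ _ := eq_eqToHom_conj rfl rfl _
    map₂_whisker_right _ _ := eq_eqToHom_conj rfl rfl _ }

/-- The forgetful 2-functor from algebras and colax morphisms. -/
def colaxForget : StrictPseudofunctor M.ColaxAlg C :=
  .mk'' {
    obj X := X.alg.carrier
    map f := ColaxMor.hom f
    map₂ α := ColaxMor₂.hom α
    map₂_id _ := rfl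
    map₂_comp _ _ := rfl
    map_id _ := rfl
    map_comp _ _ := rfl
    map₂_whisker_left _ _ _ _ := eq_eqToHom_conj rfl rfl _
    map₂_whisker_right _ _ := eq_eqToHom_conj rfl rfl _ }

/-- The forgetful `F`-functor `U : T-𝔸lg_w ⟶ C`. -/
def forget : ∀ w : Weakness, FFunctor (M.algFCategory w) (.ofTwoCategory C)
  | .lax => ⟨M.laxForget, fun _ _ => trivial⟩
  | .pseudo => ⟨M.pseudoLaxFCategory.tightInclusion.comp M.laxForget, fun _ _ => trivial⟩
  | .colax => ⟨M.colaxForget, fun _ _ => trivial⟩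

variable {M}

/-- A strict morphism regarded as a lax morphism with identity 2-cell. -/
def StrictMor.toLax {X Y : M.Algebra} (f : StrictMor X Y) : LaxMor X Y where
  hom := f.hom
  cell := eqToHom f.comm
  unit := by simp
  mult := by simp [PrelaxFunctor.map₂_eqToHom]

/-- A strict morphism regarded as a colax morphism with identity 2-cell. -/
def StrictMor.toColax {X Y : M.Algebra} (f : StrictMor X Y) : ColaxMor X Y where
  hom := f.hom
  cell := eqToHom f.comm.symm
  unit := by simp
  mult := by simp [PrelaxFunctor.map₂_eqToHom]

theorem StrictMor.toLax_comp {X Y Z : M.Algebra} (f : StrictMor X Y) (g : StrictMor Y Z) :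
    (f.comp g).toLax = f.toLax.comp g.toLax :=
  LaxMor.eq_of_cell (f := f.hom ≫ g.hom) rfl rfl rfl (cf := eqToHom (f.comp g).comm)
    (cg := LaxMor.compCell (eqToHom f.comm) (eqToHom g.comm)) .rfl .rfl
    (by rw [LaxMor.compCell_eqToHom]; simp)

theorem StrictMor.toColax_comp {X Y Z : M.Algebra} (f : StrictMor X Y) (g : StrictMor Y Z) :
    (f.comp g).toColax = f.toColax.comp g.toColax :=
  ColaxMor.eq_of_cell (f := f.hom ≫ g.hom) rfl rfl rfl (cf := eqToHom (f.comp g).comm.symm)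
    (cg := ColaxMor.compCell (eqToHom f.comm.symm) (eqToHom g.comm.symm)) .rfl .rfl
    (by rw [ColaxMor.compCell_eqToHom]; simp)

/-- A 2-cell of strict morphisms regarded as a 2-cell of lax morphisms. -/
def StrictMor₂.toLax {X Y : M.Algebra} {f g : StrictMor X Y} (α : StrictMor₂ f g) :
    LaxMor₂ f.toLax g.toLax where
  hom := α.hom
  comm := α.comm.symm

/-- A 2-cell of strict morphisms regarded as a 2-cell of colax morphisms. -/
def StrictMor₂.toColax {X Y : M.Algebra} {f g : StrictMor X Y} (α : StrictMor₂ f g) :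
    ColaxMor₂ f.toColax g.toColax where
  hom := α.hom
  comm := by
    change eqToHom f.comm.symm ≫ M.T.map₂ α.hom ▷ Y.str = X.str ◁ α.hom ≫ eqToHom g.comm.symm
    rw [eqToHom_comp_iff, ← Category.assoc, ← comp_eqToHom_iff]
    exact α.comm

variable (M)

/-- The inclusion of strict morphisms in lax morphisms. -/
def strictToLax : StrictPseudofunctor M.StrictAlg M.LaxAlg :=
  .mk'' {
    obj X := ⟨X.alg⟩
    map f := StrictMor.toLax f
    map₂ α := StrictMor₂.toLax α
    map₂_id _ := rfl
    map₂_comp _ _ := rfl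
    map_id _ := rfl
    map_comp f g := StrictMor.toLax_comp f g
    map₂_whisker_left f _ _ α := LaxMor₂.ext (by
      rw [LaxAlg.conj_hom]
      exact eq_eqToHom_conj rfl rfl _)
    map₂_whisker_right α f := LaxMor₂.ext (by
      rw [LaxAlg.conj_hom]
      exact eq_eqToHom_conj rfl rfl _) }

/-- The inclusion of strict morphisms in colax morphisms. -/
def strictToColax : StrictPseudofunctor M.StrictAlg M.ColaxAlg :=
  .mk'' {
    obj X := ⟨X.alg⟩
    map f := StrictMor.toColax f
    map₂ α := StrictMor₂.toColax α
    map₂_id _ := rfl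
    map₂_comp _ _ := rfl
    map_id _ := rfl
    map_comp f g := StrictMor.toColax_comp f g
    map₂_whisker_left f _ _ α := ColaxMor₂.ext (by
      rw [ColaxAlg.conj_hom]
      exact eq_eqToHom_conj rfl rfl _)
    map₂_whisker_right α f := ColaxMor₂.ext (by
      rw [ColaxAlg.conj_hom]
      exact eq_eqToHom_conj rfl rfl _) }

/-- The inclusion of strict morphisms in pseudomorphisms. -/
def strictToPseudo : StrictPseudofunctor M.StrictAlg M.pseudoLaxFCategory.Tight :=
  FCategory.liftTight (𝔸 := M.pseudoLaxFCategory) M.strictToLax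
    fun f => inferInstanceAs (IsIso (eqToHom (StrictMor.comm f)))

/-- The inclusion `j_w : T-Alg_s ⟶ T-𝔸lg_w`. -/
def algInclusion : ∀ w : Weakness, FFunctor (.ofTwoCategory M.StrictAlg) (M.algFCategory w)
  | .lax => ⟨M.strictToLax, fun f _ => ⟨StrictMor.comm f, rfl⟩⟩
  | .pseudo => ⟨M.strictToPseudo, fun f _ => ⟨StrictMor.comm f, rfl⟩⟩
  | .colax => ⟨M.strictToColax, fun f _ => ⟨(StrictMor.comm f).symm, rfl⟩⟩

end TwoMonad

/-- The Eilenberg-Moore comparison 2-functor of a 2-adjunction `F ⊣ G`, sending `X` to the algebra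
`(G X, G ε_X)` and acting as `G` on 1-cells and 2-cells. -/
def TwoAdjunction.comparison {B : Type u₁} [Bicategory.{w₁, v₁} B] [Bicategory.Strict B]
    {C : Type u₂} [Bicategory.{w₂, v₂} C] [Bicategory.Strict C] {F : StrictPseudofunctor B C}
    {G : StrictPseudofunctor C B} (adj : TwoAdjunction F G) :
    StrictPseudofunctor C adj.monad.StrictAlg :=
  .mk'' {
    obj X := ⟨{
      carrier := G.obj X
      str := G.map (adj.counit.app X)
      unit := adj.right_triangle X
      assoc := ((G.map_comp _ _).symm.trans
        ((congrArg (fun k => G.map k) (adj.counit.naturality (adj.counit.app X))).trans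
          (G.map_comp _ _))).symm }⟩
    map f := {
      hom := G.map f
      comm := (G.map_comp _ _).symm.trans
        ((congrArg (fun k => G.map k) (adj.counit.naturality f)).trans (G.map_comp _ _)) }
    map₂ α := {
      hom := G.map₂ α
      comm := G.map₂_square (adj.counit.naturality₂ α) _ _ }
    map₂_id f := TwoMonad.StrictMor₂.ext (G.map₂_id f)
    map₂_comp α β := TwoMonad.StrictMor₂.ext (G.map₂_comp α β)
    map_id X := TwoMonad.StrictMor.ext (G.map_id X)
    map_comp f g := TwoMonad.StrictMor.ext (G.map_comp f g)
    map₂_whisker_left f _ _ α := TwoMonad.StrictMor₂.ext (by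
      rw [TwoMonad.StrictAlg.conj_hom]
      exact G.map₂_whiskerLeft_eqToHom f α)
    map₂_whisker_right α f := TwoMonad.StrictMor₂.ext (by
      rw [TwoMonad.StrictAlg.conj_hom]
      exact G.map₂_whiskerRight_eqToHom α f) }

/-! Write `G = F H`, a 2-functor on all loose morphisms with tight values, and let `ε : G ⇒ 1` be
the counit, which is natural only for tight morphisms. To extend the comparison to a loose `f : A ⟶
B`, one needs a 2-cell `ε_B · G f ⇒ f · ε_A` whose image under `H` can serve as structure 2-cell
(reversed throughout in the colax case).

The limit of `f` supplies it. Let `p`, `q` be the tight projections from `L` and `λ : q ⇒ f p` the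
universal 2-cell. The identity cone gives a section `r` with `p r = 1`, `q r = f` and `λ r = 1`.
Since `ε` is natural at `p` and `q`, the whiskering `λ · ε_L · G r` has exactly the required
boundary; this is `Resolution.natCell`.

Its properties come from one pasting equation, `Resolution.oComp_of_tight`: for every 2-cell `c : s
⇒ f p'` with `s` and `p'` tight, pasting `G c` with the 2-cell of `f` gives `c` whiskered by `ε`.
For `c = λ` this is interchange with the 2-cell `1 ⇒ r p` (`oComp_cell`); the general case follows
by lifting the cone along a tight morphism. A pseudolimit lifts only invertible cones, so there a
non-invertible `c` is first divided by an invertible limit 2-cell. Suitable choices of `c` give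
identities at tight morphisms, compatibility with composition and compatibility with 2-cells.
Compatibility with the 2-cell of `f` itself is the multiplication law; the unit law follows from `λ
r = 1` and a triangle identity.

For uniqueness, any extension yields structure 2-cells satisfying `TightCounit.IsNatural`.
Compatibility with `λ`, whose domain is tight, then forces the 2-cell at `f` after restriction along
`G r` (`IsNatural.eq_structureCell`). -/

/-! ### Bundled 2-cells and whiskering in a strict 2-category. -/

/-- A 2-cell together with its boundary 1-cells. Equality of such bundled 2-cells allows pasting in
a strict 2-category without transport along equalities of 1-cells. -/
structure TwoCell {K : Type u} [Bicategory.{w, v} K] (X Y : K) where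
  {src : X ⟶ Y}
  {tgt : X ⟶ Y}
  hom : (homCategory X Y).Hom src tgt

namespace TwoCell

variable {K : Type u} [Bicategory.{w, v} K]

/-- The passage between the two languages: once both boundaries are fixed, equality of bundled
2-cells carries no transport. -/
theorem mk_inj_iff {X Y : K} {f g : X ⟶ Y} {α β : f ⟶ g} :
    TwoCell.mk α = TwoCell.mk β ↔ α = β := by
  constructor
  · intro h
    cases h
    rfl
  · rintro rfl
    rfl

/-- The identity 2-cell of a 1-cell. -/
def one {X Y : K} (f : X ⟶ Y) : TwoCell X Y := ⟨𝟙 f⟩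

/-- Whiskering by a 1-cell on the left. -/
def wl {X Y Z : K} (f : X ⟶ Y) (a : TwoCell Y Z) : TwoCell X Z := ⟨f ◁ a.hom⟩

/-- Whiskering by a 1-cell on the right. -/
def wr {X Y Z : K} (a : TwoCell X Y) (g : Y ⟶ Z) : TwoCell X Z := ⟨a.hom ▷ g⟩

/-- The image of a 2-cell under a 2-functor. -/
def map {C : Type u₁} [Bicategory.{w₁, v₁} C] (F : StrictPseudofunctor K C) {X Y : K}
    (a : TwoCell X Y) : TwoCell (F.obj X) (F.obj Y) := ⟨F.map₂ a.hom⟩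

@[simp]
theorem mk_eqToHom {X Y : K} {f g : X ⟶ Y} (h : f = g) : TwoCell.mk (eqToHom h) = one g := by
  subst h; rfl

@[simp]
-- An `eqToHom` changes only the name of a boundary 1-cell, and the bundle already allows that to
-- vary; so all such corrections disappear from pasting equations.
theorem mk_eqToHom_comp {X Y : K} {f f' g : X ⟶ Y} (h : f = f') (α : f' ⟶ g) :
    TwoCell.mk (eqToHom h ≫ α) = ⟨α⟩ := by
  subst h; simp

@[simp]
theorem mk_comp_eqToHom {X Y : K} {f g g' : X ⟶ Y} (h : g = g') (α : f ⟶ g) :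
    TwoCell.mk (α ≫ eqToHom h) = ⟨α⟩ := by
  subst h; simp

@[simp]
theorem mk_whiskerLeft {X Y Z : K} (f : X ⟶ Y) {g h : Y ⟶ Z} (α : g ⟶ h) :
    TwoCell.mk (f ◁ α) = wl f ⟨α⟩ := rfl

@[simp]
theorem mk_whiskerRight {X Y Z : K} {f g : X ⟶ Y} (α : f ⟶ g) (h : Y ⟶ Z) :
    TwoCell.mk (α ▷ h) = wr ⟨α⟩ h := rfl

@[simp]
theorem mk_map₂ {C : Type u₁} [Bicategory.{w₁, v₁} C] (F : StrictPseudofunctor K C) {X Y : K}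
    {f g : X ⟶ Y} (α : f ⟶ g) : TwoCell.mk (F.map₂ α) = map F ⟨α⟩ := rfl

@[simp]
theorem wl_one {X Y Z : K} (f : X ⟶ Y) (g : Y ⟶ Z) : wl f (one g) = one (f ≫ g) := by
  exact mk_inj_iff.2 (whiskerLeft_id f g)

@[simp]
theorem wr_one {X Y Z : K} (f : X ⟶ Y) (g : Y ⟶ Z) : wr (one f) g = one (f ≫ g) := by
  exact mk_inj_iff.2 (id_whiskerRight f g)

@[simp]
theorem map_one {C : Type u₁} [Bicategory.{w₁, v₁} C] (F : StrictPseudofunctor K C) {X Y : K}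
    (f : X ⟶ Y) : map F (one f) = one (F.map f) := by
  exact mk_inj_iff.2 (F.map₂_id f)

theorem map_wl {C : Type u₁} [Bicategory.{w₁, v₁} C] (F : StrictPseudofunctor K C) {X Y Z : K}
    (f : X ⟶ Y) (a : TwoCell Y Z) : map F (wl f a) = wl (F.map f) (map F a) := by
  simp only [map, wl, F.map₂_whiskerLeft_eqToHom, mk_eqToHom_comp, mk_comp_eqToHom]

theorem map_wr {C : Type u₁} [Bicategory.{w₁, v₁} C] (F : StrictPseudofunctor K C) {X Y Z : K}
    (a : TwoCell X Y) (g : Y ⟶ Z) : map F (wr a g) = wr (map F a) (F.map g) := by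
  simp only [map, wr, F.map₂_whiskerRight_eqToHom, mk_eqToHom_comp, mk_comp_eqToHom]

section Strict

variable [Bicategory.Strict K]

@[simp]
-- The unitors of a strict 2-category are `eqToHom`s, which bundling absorbs. The next three laws
-- hold because the associators are absorbed in the same way.
theorem id_wl {X Y : K} (a : TwoCell X Y) : wl (𝟙 X) a = a := by
  simp [wl, id_whiskerLeft, Strict.leftUnitor_eqToIso, -mk_whiskerLeft]

@[simp]
theorem wl_wl {X Y Z W : K} (f : X ⟶ Y) (g : Y ⟶ Z) (a : TwoCell Z W) :
    wl f (wl g a) = wl (f ≫ g) a := by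
  simp [wl, Strict.associator_eqToIso, -mk_whiskerLeft]

@[simp]
theorem wr_wr {X Y Z W : K} (a : TwoCell X Y) (g : Y ⟶ Z) (h : Z ⟶ W) :
    wr (wr a g) h = wr a (g ≫ h) := by
  simp [wr, Strict.associator_eqToIso, -mk_whiskerRight]

@[simp]
theorem wr_wl {X Y Z W : K} (f : X ⟶ Y) (a : TwoCell Y Z) (h : Z ⟶ W) :
    wr (wl f a) h = wl f (wr a h) := by
  simp [wr, wl, Strict.associator_eqToIso, -mk_whiskerRight, -mk_whiskerLeft]

end Strict

/-- Allows a bundled 2-cell to fill a field whose type prescribes the boundary, as in the morphisms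
of algebras. -/
theorem mk_cast {X Y : K} {f g : X ⟶ Y} {a : TwoCell X Y} (hf : a.src = f) (hg : a.tgt = g) :
    TwoCell.mk (eqToHom hf.symm ≫ a.hom ≫ eqToHom hg) = a := by
  simp

/-! ### Vertical composition as a relation, in either orientation. -/

/-- `VComp a b c` says that `c` is the vertical composite of `a` followed by `b`. -/
inductive VComp {X Y : K} : TwoCell X Y → TwoCell X Y → TwoCell X Y → Prop
  | mk {f g h : X ⟶ Y} (α : f ⟶ g) (β : g ⟶ h) : VComp ⟨α⟩ ⟨β⟩ ⟨α ≫ β⟩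

/-- The multiplication axioms and `compCell` both have this shape: two 2-cells composed through an
equality of 1-cells. -/
theorem VComp.mk_eqToHom {X Y : K} {f g g' h h' : X ⟶ Y} (α : f ⟶ g) (e : g = g') (β : g' ⟶ h)
    (e' : h = h') : VComp ⟨α⟩ ⟨β⟩ ⟨α ≫ eqToHom e ≫ β ≫ eqToHom e'⟩ := by
  subst e e'
  rw [eqToHom_refl, eqToHom_refl, Category.id_comp, Category.comp_id]
  exact .mk α β

/-- The domain of a 2-cell, with 2-cells reversed when `w` is colax. -/
def dom (w : Weakness) {X Y : K} (a : TwoCell X Y) : X ⟶ Y :=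
  match w with
  | .colax => a.tgt
  | _ => a.src

/-- The codomain of a 2-cell, with 2-cells reversed when `w` is colax. -/
def cod (w : Weakness) {X Y : K} (a : TwoCell X Y) : X ⟶ Y :=
  match w with
  | .colax => a.src
  | _ => a.tgt

/-- Vertical composition, with 2-cells reversed when `w` is colax. -/
def OComp (w : Weakness) {X Y : K} (a b c : TwoCell X Y) : Prop :=
  match w with
  | .colax => VComp b a c
  | _ => VComp a b c

section Oriented

variable {w : Weakness} {X Y Z : K}

@[simp]
theorem dom_one (f : X ⟶ Y) : dom w (one f) = f := by cases w <;> rfl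

@[simp]
theorem cod_one (f : X ⟶ Y) : cod w (one f) = f := by cases w <;> rfl

@[simp]
theorem dom_wl (f : X ⟶ Y) (a : TwoCell Y Z) : dom w (wl f a) = f ≫ dom w a := by
  cases w <;> rfl

@[simp]
theorem cod_wl (f : X ⟶ Y) (a : TwoCell Y Z) : cod w (wl f a) = f ≫ cod w a := by
  cases w <;> rfl

@[simp]
theorem dom_wr (a : TwoCell X Y) (g : Y ⟶ Z) : dom w (wr a g) = dom w a ≫ g := by
  cases w <;> rfl

@[simp]
theorem cod_wr (a : TwoCell X Y) (g : Y ⟶ Z) : cod w (wr a g) = cod w a ≫ g := by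
  cases w <;> rfl

@[simp]
theorem dom_map {C : Type u₁} [Bicategory.{w₁, v₁} C] (F : StrictPseudofunctor K C)
    (a : TwoCell X Y) : dom w (map F a) = F.map (dom w a) := by cases w <;> rfl

@[simp]
theorem cod_map {C : Type u₁} [Bicategory.{w₁, v₁} C] (F : StrictPseudofunctor K C)
    (a : TwoCell X Y) : cod w (map F a) = F.map (cod w a) := by cases w <;> rfl

theorem VComp.exists_of_eq {a b : TwoCell X Y} (h : a.tgt = b.src) : ∃ c, VComp a b c := by
  obtain ⟨α⟩ := a
  obtain ⟨β⟩ := b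
  dsimp only at h
  subst h
  exact ⟨_, .mk α β⟩

theorem VComp.unique {a b c c' : TwoCell X Y} (h : VComp a b c) (h' : VComp a b c') : c = c' := by
  obtain ⟨α, β⟩ := h
  cases h'
  rfl

theorem VComp.assoc {a b c ab bc abc : TwoCell X Y} (h₁ : VComp a b ab) (h₂ : VComp b c bc)
    (h₃ : VComp a bc abc) : VComp ab c abc := by
  obtain ⟨α, β⟩ := h₁
  obtain ⟨_, γ⟩ := h₂
  cases h₃
  rw [← Category.assoc]
  exact .mk _ _

/-- Reversing 2-cells exchanges the two bracketings, so `OComp.assoc` needs this direction in the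
colax case. -/
theorem VComp.assoc' {a b c ab bc abc : TwoCell X Y} (h₁ : VComp a b ab) (h₂ : VComp b c bc)
    (h₃ : VComp ab c abc) : VComp a bc abc := by
  obtain ⟨α, β⟩ := h₁
  obtain ⟨_, γ⟩ := h₂
  cases h₃
  rw [Category.assoc]
  exact .mk _ _

theorem VComp.dom_eq {a b c : TwoCell X Y} (h : VComp a b c) : c.src = a.src := by cases h; rfl

theorem VComp.cod_eq {a b c : TwoCell X Y} (h : VComp a b c) : c.tgt = b.tgt := by cases h; rfl

theorem VComp.cod_eq_dom {a b c : TwoCell X Y} (h : VComp a b c) : a.tgt = b.src := by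
  cases h; rfl

theorem OComp.exists_of_eq {a b : TwoCell X Y} (h : cod w a = dom w b) : ∃ c, OComp w a b c := by
  cases w
  exacts [VComp.exists_of_eq h, VComp.exists_of_eq h, VComp.exists_of_eq h.symm]

theorem OComp.unique {a b c c' : TwoCell X Y} (h : OComp w a b c) (h' : OComp w a b c') :
    c = c' := by
  cases w
  all_goals exact VComp.unique h h'

theorem OComp.assoc {a b c ab bc abc : TwoCell X Y} (h₁ : OComp w a b ab) (h₂ : OComp w b c bc)
    (h₃ : OComp w a bc abc) : OComp w ab c abc := by
  cases w
  exacts [VComp.assoc h₁ h₂ h₃, VComp.assoc h₁ h₂ h₃, VComp.assoc' h₂ h₁ h₃]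

theorem OComp.dom_eq {a b c : TwoCell X Y} (h : OComp w a b c) : dom w c = dom w a := by
  cases w
  exacts [VComp.dom_eq h, VComp.dom_eq h, VComp.cod_eq h]

theorem OComp.cod_eq {a b c : TwoCell X Y} (h : OComp w a b c) : cod w c = cod w b := by
  cases w
  exacts [VComp.cod_eq h, VComp.cod_eq h, VComp.dom_eq h]

theorem OComp.cod_eq_dom {a b c : TwoCell X Y} (h : OComp w a b c) : cod w a = dom w b := by
  cases w
  exacts [VComp.cod_eq_dom h, VComp.cod_eq_dom h, (VComp.cod_eq_dom h).symm]

theorem VComp.one_left (a : TwoCell X Y) : VComp (one a.src) a a := by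
  have h := VComp.mk (𝟙 a.src) a.hom
  rwa [Category.id_comp] at h

theorem VComp.one_right (a : TwoCell X Y) : VComp a (one a.tgt) a := by
  have h := VComp.mk a.hom (𝟙 a.tgt)
  rwa [Category.comp_id] at h

theorem OComp.one_right {a : TwoCell X Y} {f : X ⟶ Y} (h : cod w a = f) :
    OComp w a (one f) a := by
  subst h
  cases w
  exacts [VComp.one_right a, VComp.one_right a, VComp.one_left a]

theorem VComp.eq_of_one_left {f : X ⟶ Y} {a c : TwoCell X Y} (h : VComp (one f) a c) : c = a := by
  generalize hb : one f = b at h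
  cases h
  cases hb
  rw [Category.id_comp]

theorem VComp.eq_of_one_right {f : X ⟶ Y} {a c : TwoCell X Y} (h : VComp a (one f) c) :
    c = a := by
  generalize hb : one f = b at h
  cases h
  cases hb
  rw [Category.comp_id]

theorem OComp.eq_of_one_left {f : X ⟶ Y} {a c : TwoCell X Y} (h : OComp w (one f) a c) :
    c = a := by
  cases w
  exacts [VComp.eq_of_one_left h, VComp.eq_of_one_left h, VComp.eq_of_one_right h]

theorem OComp.eq_of_one_right {f : X ⟶ Y} {a c : TwoCell X Y} (h : OComp w a (one f) c) :
    c = a := by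
  cases w
  exacts [VComp.eq_of_one_right h, VComp.eq_of_one_right h, VComp.eq_of_one_left h]

theorem VComp.wl {a b c : TwoCell Y Z} (h : VComp a b c) (f : X ⟶ Y) :
    VComp (wl f a) (wl f b) (wl f c) := by
  obtain ⟨α, β⟩ := h
  simp only [TwoCell.wl, whiskerLeft_comp]
  exact .mk _ _

theorem VComp.wr {a b c : TwoCell X Y} (h : VComp a b c) (g : Y ⟶ Z) :
    VComp (wr a g) (wr b g) (wr c g) := by
  obtain ⟨α, β⟩ := h
  simp only [TwoCell.wr, comp_whiskerRight]
  exact .mk _ _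

theorem VComp.map {C : Type u₁} [Bicategory.{w₁, v₁} C] (F : StrictPseudofunctor K C)
    {a b c : TwoCell X Y} (h : VComp a b c) : VComp (map F a) (map F b) (map F c) := by
  obtain ⟨α, β⟩ := h
  simp only [TwoCell.map, F.map₂_comp]
  exact .mk _ _

theorem OComp.wl {a b c : TwoCell Y Z} (h : OComp w a b c) (f : X ⟶ Y) :
    OComp w (wl f a) (wl f b) (wl f c) := by
  cases w
  all_goals exact VComp.wl h f

theorem OComp.wr {a b c : TwoCell X Y} (h : OComp w a b c) (g : Y ⟶ Z) :
    OComp w (wr a g) (wr b g) (wr c g) := by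
  cases w
  all_goals exact VComp.wr h g

theorem OComp.map {C : Type u₁} [Bicategory.{w₁, v₁} C] (F : StrictPseudofunctor K C)
    {a b c : TwoCell X Y} (h : OComp w a b c) : OComp w (map F a) (map F b) (map F c) := by
  cases w
  all_goals exact VComp.map F h

/-- The interchange law. -/
theorem OComp.interchange (a : TwoCell X Y) (b : TwoCell Y Z) :
    ∃ c, OComp w (TwoCell.wl (dom w a) b) (TwoCell.wr a (cod w b)) c ∧
      OComp w (TwoCell.wr a (dom w b)) (TwoCell.wl (cod w a) b) c := by
  have h₁ := VComp.mk (a.src ◁ b.hom) (a.hom ▷ b.tgt)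
  have h₂ := VComp.mk (a.hom ▷ b.src) (a.tgt ◁ b.hom)
  rw [whisker_exchange] at h₁
  cases w
  exacts [⟨_, h₁, h₂⟩, ⟨_, h₁, h₂⟩, ⟨_, h₂, h₁⟩]

end Oriented

end TwoCell

namespace TwoCell

variable {K : Type u} [Bicategory.{w, v} K] {X Y : K}

theorem exists_eq_mk {a : TwoCell X Y} {f g : X ⟶ Y} (hf : a.src = f) (hg : a.tgt = g) :
    ∃ α : f ⟶ g, a = ⟨α⟩ := by
  subst hf hg
  exact ⟨a.hom, rfl⟩

/-- Division by an invertible 2-cell. It reduces arbitrary cones to invertible ones in the pseudo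
case. -/
theorem exists_oComp_of_isIso {w : Weakness} {a c : TwoCell X Y} (ha : IsIso a.hom)
    (h : cod w a = cod w c) : ∃ b, OComp w b a c := by
  obtain ⟨α⟩ := a
  obtain ⟨γ⟩ := c
  dsimp only at ha
  cases w
  case colax =>
    dsimp only [cod] at h
    subst h
    refine ⟨⟨inv α ≫ γ⟩, ?_⟩
    have := VComp.mk α (inv α ≫ γ)
    rwa [IsIso.hom_inv_id_assoc] at this
  all_goals
    dsimp only [cod] at h
    subst h
    refine ⟨⟨γ ≫ inv α⟩, ?_⟩
    have := VComp.mk (γ ≫ inv α) α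
    rwa [Category.assoc, IsIso.inv_hom_id, Category.comp_id] at this

end TwoCell

/-! ### Resolutions of loose morphisms, obtained from the three kinds of limit. -/

open TwoCell

namespace FCategory

variable {𝔸 : FCategory.{w, v, u}}

/-- A factorization `f = q r` of a loose morphism through a section `r` of a tight morphism `p`,
where `q` is tight and `cell : q ⇒ f p` (reversed when `w` is colax) is universal among cones with
tight legs. -/
structure Resolution (𝔸 : FCategory.{w, v, u}) (w : Weakness) {A B : 𝔸.Obj} (f : A ⟶ B) where
  L : 𝔸.Obj
  p : L ⟶ A
  q : L ⟶ B
  r : A ⟶ L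
  cell : TwoCell L B
  unit : TwoCell L L
  tight_p : 𝔸.IsTight p
  tight_q : 𝔸.IsTight q
  dom_cell : dom w cell = q
  cod_cell : cod w cell = p ≫ f
  r_p : r ≫ p = 𝟙 A
  r_q : r ≫ q = f
  r_cell : wl r cell = one f
  dom_unit : dom w unit = 𝟙 L
  cod_unit : cod w unit = p ≫ r
  unit_p : wr unit p = one p
  unit_q : wr unit q = cell
  isIso_cell : w = .pseudo → IsIso cell.hom
  lift : ∀ {M : 𝔸.Obj} {p' : M ⟶ A} {c : TwoCell M B}, 𝔸.IsTight p' → 𝔸.IsTight (dom w c) →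
    cod w c = p' ≫ f → (w = .pseudo → IsIso c.hom) →
    ∃ t : M ⟶ L, 𝔸.IsTight t ∧ t ≫ p = p' ∧ wl t cell = c

variable {A B L X : 𝔸.Obj} {f : A ⟶ B}

/-- The leg `s` needs no separate clause: it is the source of the 2-cell, and the bundle remembers
it. -/
theorem _root_.ColaxCone.eq_iff {c d : ColaxCone f X} :
    c = d ↔ c.r = d.r ∧ TwoCell.mk c.α = TwoCell.mk d.α := by
  refine ⟨fun h => h ▸ ⟨rfl, rfl⟩, fun ⟨h₁, h₂⟩ => ?_⟩
  obtain ⟨r, s, α⟩ := c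
  obtain ⟨r', s', α'⟩ := d
  dsimp only at h₁ h₂
  subst h₁
  cases h₂
  rfl

theorem _root_.LaxCone.eq_iff {c d : LaxCone f X} :
    c = d ↔ c.r = d.r ∧ TwoCell.mk c.α = TwoCell.mk d.α := by
  refine ⟨fun h => h ▸ ⟨rfl, rfl⟩, fun ⟨h₁, h₂⟩ => ?_⟩
  obtain ⟨r, s, α⟩ := c
  obtain ⟨r', s', α'⟩ := d
  dsimp only at h₁ h₂
  subst h₁
  cases h₂
  rfl

theorem _root_.ColaxCone.precomp_eq_iff {c : ColaxCone f L} {t : X ⟶ L} {d : ColaxCone f X} :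
    c.precomp t = d ↔ t ≫ c.r = d.r ∧ wl t ⟨c.α⟩ = ⟨d.α⟩ := by
  rw [ColaxCone.eq_iff]
  simp [ColaxCone.precomp, Strict.associator_eqToIso]

theorem _root_.LaxCone.precomp_eq_iff {c : LaxCone f L} {t : X ⟶ L} {d : LaxCone f X} :
    c.precomp t = d ↔ t ≫ c.r = d.r ∧ wl t ⟨c.α⟩ = ⟨d.α⟩ := by
  rw [LaxCone.eq_iff]
  simp [LaxCone.precomp, Strict.associator_eqToIso]

theorem exists_colaxCone {r : X ⟶ A} {a : TwoCell X B} (h : a.tgt = r ≫ f) :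
    ∃ d : ColaxCone f X, d.r = r ∧ TwoCell.mk d.α = a :=
  ⟨⟨r, a.src, a.hom ≫ eqToHom h⟩, rfl, by simp⟩

theorem exists_laxCone {r : X ⟶ A} {a : TwoCell X B} (h : a.src = r ≫ f) :
    ∃ d : LaxCone f X, d.r = r ∧ TwoCell.mk d.α = a :=
  ⟨⟨r, a.tgt, eqToHom h.symm ≫ a.hom⟩, rfl, by simp⟩

/-- The common content of the three kinds of limit of a loose morphism `f`. -/
structure IsBarLimit (w : Weakness) (f : A ⟶ B) (p : L ⟶ A) (q : L ⟶ B) (c : TwoCell L B) :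
    Prop where
  dom_eq : dom w c = q
  cod_eq : cod w c = p ≫ f
  isIso : w = .pseudo → IsIso c.hom
  fac : ∀ {X : 𝔸.Obj} {r : X ⟶ A} {a : TwoCell X B}, cod w a = r ≫ f →
    (w = .pseudo → IsIso a.hom) → ∃ t : X ⟶ L, t ≫ p = r ∧ wl t c = a
  cell : ∀ {X : 𝔸.Obj} {t t' : X ⟶ L} {θr : TwoCell X A} {θs d : TwoCell X B},
    dom w θr = t ≫ p → cod w θr = t' ≫ p → dom w θs = t ≫ q → cod w θs = t' ≫ q →
    OComp w (wl t c) (wr θr f) d → OComp w θs (wl t' c) d → ∃ φ : TwoCell X L,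
      dom w φ = t ∧ cod w φ = t' ∧ wr φ p = θr ∧ wr φ q = θs
  detectsTight : 𝔸.DetectsTight p q

theorem _root_.ColaxCone.compatible_iff {c d : ColaxCone f X} {θr : c.r ⟶ d.r} {θs : c.s ⟶ d.s} :
    c.Compatible d θr θs ↔ ∃ e, VComp ⟨c.α⟩ (wr ⟨θr⟩ f) e ∧ VComp ⟨θs⟩ ⟨d.α⟩ e := by
  refine ⟨fun h => ⟨_, .mk _ _, ?_⟩, fun ⟨e, h₁, h₂⟩ => mk_inj_iff.1 ?_⟩
  · have h' := VComp.mk θs d.α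
    rwa [← h] at h'
  · exact (VComp.unique (.mk _ _) h₁).trans (VComp.unique h₂ (.mk _ _))

theorem _root_.LaxCone.compatible_iff {c d : LaxCone f X} {θr : c.r ⟶ d.r} {θs : c.s ⟶ d.s} :
    c.Compatible d θr θs ↔ ∃ e, VComp ⟨c.α⟩ ⟨θs⟩ e ∧ VComp (wr ⟨θr⟩ f) ⟨d.α⟩ e := by
  refine ⟨fun h => ⟨_, .mk _ _, ?_⟩, fun ⟨e, h₁, h₂⟩ => mk_inj_iff.1 ?_⟩
  · have h' := VComp.mk (θr ▷ f) d.α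
    rwa [← h] at h'
  · exact (VComp.unique (.mk _ _) h₁).trans (VComp.unique h₂ (.mk _ _))

theorem _root_.ColaxCone.mk_precomp {c : ColaxCone f L} {t : X ⟶ L} :
    TwoCell.mk (c.precomp t).α = wl t ⟨c.α⟩ := by
  simp [ColaxCone.precomp, Strict.associator_eqToIso]

theorem _root_.LaxCone.mk_precomp {c : LaxCone f L} {t : X ⟶ L} :
    TwoCell.mk (c.precomp t).α = wl t ⟨c.α⟩ := by
  simp [LaxCone.precomp, Strict.associator_eqToIso]

theorem _root_.ColaxCone.exists_cell {c : ColaxCone f L}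
    (hc : ∀ {X : 𝔸.Obj} (t t' : X ⟶ L) (θr : t ≫ c.r ⟶ t' ≫ c.r)
      (θs : t ≫ c.s ⟶ t' ≫ c.s), (c.precomp t).Compatible (c.precomp t') θr θs →
      ∃! φ : t ⟶ t', φ ▷ c.r = θr ∧ φ ▷ c.s = θs)
    {t t' : X ⟶ L} {θr : TwoCell X A} {θs d : TwoCell X B} (h₁ : θr.src = t ≫ c.r)
    (h₂ : θr.tgt = t' ≫ c.r) (h₃ : θs.src = t ≫ c.s) (h₄ : θs.tgt = t' ≫ c.s)
    (h₅ : VComp (wl t ⟨c.α⟩) (wr θr f) d) (h₆ : VComp θs (wl t' ⟨c.α⟩) d) :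
    ∃ φ : TwoCell X L, φ.src = t ∧ φ.tgt = t' ∧ wr φ c.r = θr ∧ wr φ c.s = θs := by
  obtain ⟨θr, rfl⟩ := exists_eq_mk h₁ h₂
  obtain ⟨θs, rfl⟩ := exists_eq_mk h₃ h₄
  rw [← ColaxCone.mk_precomp] at h₅ h₆
  obtain ⟨φ, ⟨h, h'⟩, -⟩ := hc t t' θr θs (ColaxCone.compatible_iff.2 ⟨d, h₅, h₆⟩)
  exact ⟨⟨φ⟩, rfl, rfl, mk_inj_iff.2 h, mk_inj_iff.2 h'⟩

theorem _root_.LaxCone.exists_cell {c : LaxCone f L}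
    (hc : ∀ {X : 𝔸.Obj} (t t' : X ⟶ L) (θr : t ≫ c.r ⟶ t' ≫ c.r)
      (θs : t ≫ c.s ⟶ t' ≫ c.s), (c.precomp t).Compatible (c.precomp t') θr θs →
      ∃! φ : t ⟶ t', φ ▷ c.r = θr ∧ φ ▷ c.s = θs)
    {t t' : X ⟶ L} {θr : TwoCell X A} {θs d : TwoCell X B} (h₁ : θr.src = t ≫ c.r)
    (h₂ : θr.tgt = t' ≫ c.r) (h₃ : θs.src = t ≫ c.s) (h₄ : θs.tgt = t' ≫ c.s)
    (h₅ : VComp (wl t ⟨c.α⟩) θs d) (h₆ : VComp (wr θr f) (wl t' ⟨c.α⟩) d) :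
    ∃ φ : TwoCell X L, φ.src = t ∧ φ.tgt = t' ∧ wr φ c.r = θr ∧ wr φ c.s = θs := by
  obtain ⟨θr, rfl⟩ := exists_eq_mk h₁ h₂
  obtain ⟨θs, rfl⟩ := exists_eq_mk h₃ h₄
  rw [← LaxCone.mk_precomp] at h₅ h₆
  obtain ⟨φ, ⟨h, h'⟩, -⟩ := hc t t' θr θs (LaxCone.compatible_iff.2 ⟨d, h₅, h₆⟩)
  exact ⟨⟨φ⟩, rfl, rfl, mk_inj_iff.2 h, mk_inj_iff.2 h'⟩

theorem IsColaxLimit.isBarLimit {c : ColaxCone f L} (hc : 𝔸.IsColaxLimit c) :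
    IsBarLimit .lax f c.r c.s ⟨c.α⟩ where
  dom_eq := rfl
  cod_eq := rfl
  isIso := nofun
  fac h _ := by
    obtain ⟨d, rfl, rfl⟩ := exists_colaxCone h
    obtain ⟨t, ht, -⟩ := hc.existsUnique_fac d
    exact ⟨t, ColaxCone.precomp_eq_iff.1 ht⟩
  cell h₁ h₂ h₃ h₄ h₅ h₆ := ColaxCone.exists_cell hc.existsUnique_cell h₁ h₂ h₃ h₄ h₅ h₆
  detectsTight := hc.detectsTight

theorem IsPseudoLimit.isBarLimit {c : ColaxCone f L} (hc : 𝔸.IsPseudoLimit c) :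
    IsBarLimit .pseudo f c.r c.s ⟨c.α⟩ where
  dom_eq := rfl
  cod_eq := rfl
  isIso _ := hc.isIso
  fac {X r a} h ha := by
    have : IsIso a.hom := ha rfl
    have h : a.tgt = r ≫ f := h
    -- The cone is written out so that invertibility of its 2-cell can be inferred; the
    -- factorisation property of a pseudolimit asks for it.
    let d : ColaxCone f X := ⟨r, a.src, a.hom ≫ eqToHom h⟩
    have hd : IsIso d.α := inferInstanceAs (IsIso (a.hom ≫ eqToHom h))
    obtain ⟨t, ht, -⟩ := hc.existsUnique_fac d hd
    refine ⟨t, ?_⟩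
    have ht := ColaxCone.precomp_eq_iff.1 ht
    exact ⟨ht.1, ht.2.trans (mk_comp_eqToHom _ _)⟩
  cell h₁ h₂ h₃ h₄ h₅ h₆ := ColaxCone.exists_cell hc.existsUnique_cell h₁ h₂ h₃ h₄ h₅ h₆
  detectsTight := hc.detectsTight

theorem IsLaxLimit.isBarLimit {c : LaxCone f L} (hc : 𝔸.IsLaxLimit c) :
    IsBarLimit .colax f c.r c.s ⟨c.α⟩ where
  dom_eq := rfl
  cod_eq := rfl
  isIso := nofun
  fac h _ := by
    obtain ⟨d, rfl, rfl⟩ := exists_laxCone h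
    obtain ⟨t, ht, -⟩ := hc.existsUnique_fac d
    exact ⟨t, LaxCone.precomp_eq_iff.1 ht⟩
  cell h₁ h₂ h₃ h₄ h₅ h₆ := by
    -- Here `dom` is the target and `cod` the source, so boundaries and the two composites enter in
    -- the opposite order.
    obtain ⟨φ, h, h', h''⟩ := LaxCone.exists_cell hc.existsUnique_cell h₂ h₁ h₄ h₃ h₆ h₅
    exact ⟨φ, h', h, h''⟩
  detectsTight := hc.detectsTight

theorem HasBarLimits.exists_isBarLimit {w : Weakness} (h : 𝔸.HasBarLimits w) (f : A ⟶ B) :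
    ∃ (L : 𝔸.Obj) (p : L ⟶ A) (q : L ⟶ B) (c : TwoCell L B), IsBarLimit w f p q c := by
  cases w
  · obtain ⟨L, c, hc⟩ := h f
    exact ⟨L, _, _, _, IsColaxLimit.isBarLimit hc⟩
  · obtain ⟨L, c, hc⟩ := h f
    exact ⟨L, _, _, _, IsPseudoLimit.isBarLimit hc⟩
  · obtain ⟨L, c, hc⟩ := h f
    exact ⟨L, _, _, _, IsLaxLimit.isBarLimit hc⟩

/-- Both the section and its unit are instances of universality: `r` classifies the identity cone on
`f`, and the 2-cell from `𝟙 L` to `p ≫ r` is induced by the pair formed of the identity of `p` and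
the limit 2-cell. Tight lifts exist because `p` and `q` jointly detect tightness. -/
theorem IsBarLimit.nonempty_resolution {w : Weakness} {p : L ⟶ A} {q : L ⟶ B} {c : TwoCell L B}
    (h : IsBarLimit w f p q c) : Nonempty (𝔸.Resolution w f) := by
  have hq {X : 𝔸.Obj} {t : X ⟶ L} {a : TwoCell X B} (ht : wl t c = a) : t ≫ q = dom w a := by
    rw [← ht, dom_wl, h.dom_eq]
  -- The identity of `f` is invertible, so this cone is admissible for pseudolimits too.
  obtain ⟨r, hr, hr'⟩ := h.fac (r := 𝟙 A) (a := one f) (by simp)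
    fun _ => inferInstanceAs (IsIso (𝟙 f))
  -- Compatibility is trivial: both composites equal `c`, since `p` carries an identity and `wl (p ≫
  -- r) c` is an identity by `hr'`.
  obtain ⟨u, hu₁, hu₂, hu₃, hu₄⟩ := h.cell (t := 𝟙 L) (t' := p ≫ r) (θr := one p) (θs := c)
    (d := c) (by simp) (by simp [hr])
    (by simp [h.dom_eq]) (by rw [h.cod_eq, Strict.assoc, hq hr', dom_one])
    (by
      rw [id_wl, wr_one]
      exact .one_right h.cod_eq)
    (by
      rw [← wl_wl, hr', wl_one]
      exact .one_right h.cod_eq)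
  exact ⟨{
    L := L, p := p, q := q, r := r, cell := c, unit := u
    tight_p := h.detectsTight.tight_left
    tight_q := h.detectsTight.tight_right
    dom_cell := h.dom_eq
    cod_cell := h.cod_eq
    r_p := hr
    r_q := by rw [hq hr', dom_one]
    r_cell := hr'
    dom_unit := hu₁
    cod_unit := hu₂
    unit_p := hu₃
    unit_q := hu₄
    isIso_cell := h.isIso
    lift := by
      intro M p' a hp' ha ha' ha''
      obtain ⟨t, ht, ht'⟩ := h.fac ha' ha''
      refine ⟨t, (h.detectsTight.detects t).2 ⟨?_, ?_⟩, ht, ht'⟩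
      · rwa [ht]
      · rwa [hq ht'] }⟩

theorem HasBarLimits.nonempty_resolution {w : Weakness} (h : 𝔸.HasBarLimits w) (f : A ⟶ B) :
    Nonempty (𝔸.Resolution w f) := by
  obtain ⟨_, _, _, _, h⟩ := h.exists_isBarLimit f
  exact h.nonempty_resolution

end FCategory

/-! ### Naturality 2-cells of the counit at loose morphisms. -/

namespace FCategory

variable {𝔸 : FCategory.{w, v, u}}

/-- A 2-functor on the loose 2-category with tight values, with tight components to the identity
which are 2-natural with respect to the tight morphisms. -/
structure TightCounit (𝔸 : FCategory.{w, v, u}) where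
  G : StrictPseudofunctor 𝔸.Obj 𝔸.Obj
  tight_map : ∀ {A B : 𝔸.Obj} (f : A ⟶ B), 𝔸.IsTight (G.map f)
  app : ∀ A : 𝔸.Obj, G.obj A ⟶ A
  tight_app : ∀ A : 𝔸.Obj, 𝔸.IsTight (app A)
  naturality : ∀ {A B : 𝔸.Obj} {f : A ⟶ B}, 𝔸.IsTight f → G.map f ≫ app B = app A ≫ f
  naturality₂ : ∀ {A B : 𝔸.Obj} {a : TwoCell A B}, 𝔸.IsTight a.src → 𝔸.IsTight a.tgt →
    wr (map G a) (app B) = wl (app A) a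

namespace Resolution

variable {w : Weakness} {A B C : 𝔸.Obj} {f : A ⟶ B} (R : 𝔸.Resolution w f) (N : 𝔸.TightCounit)

/-- The naturality 2-cell of `N` at a loose morphism. -/
def natCell : TwoCell (N.G.obj A) B := wl (N.G.map R.r ≫ N.app R.L) R.cell

/-- Naturality of `N` at the tight projection `q` moves it past `N.app R.L`, after which `r ≫ q =
f`. The codomain uses `p` and `r ≫ p = 𝟙 A` in the same way. -/
theorem dom_natCell : dom w (R.natCell N) = N.G.map f ≫ N.app B := by
  rw [natCell, dom_wl, R.dom_cell, Strict.assoc, ← N.naturality R.tight_q, ← Strict.assoc,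
    ← N.G.map_comp, R.r_q]

theorem map_r_map_p : N.G.map R.r ≫ N.G.map R.p = 𝟙 (N.G.obj A) := by
  rw [← N.G.map_comp, R.r_p, N.G.map_id]

theorem cod_natCell : cod w (R.natCell N) = N.app A ≫ f := by
  rw [natCell, cod_wl, R.cod_cell, Strict.assoc, ← Strict.assoc (N.app _),
    ← N.naturality R.tight_p, ← Strict.assoc, ← Strict.assoc, R.map_r_map_p, Strict.id_comp]

/-- The interchange law for the unit `𝟙 L ⇒ p ≫ r`, carried through `N`, against the limit 2-cell.
One way round, the unit meets `p` and becomes an identity; the other way round, it meets `q` and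
becomes the limit 2-cell. -/
theorem oComp_cell : OComp w (wr (map N.G R.cell) (N.app B)) (wl (N.G.map R.p) (R.natCell N))
    (wl (N.app R.L) R.cell) := by
  obtain ⟨c, h₁, h₂⟩ := OComp.interchange (w := w) (wr (map N.G R.unit) (N.app R.L)) R.cell
  have e₁ : wr (wr (map N.G R.unit) (N.app R.L)) (cod w R.cell) =
      one (N.G.map R.p ≫ N.app A ≫ f) := by
    rw [R.cod_cell, wr_wr, ← Strict.assoc, ← N.naturality R.tight_p, Strict.assoc, ← wr_wr,
      ← map_wr, R.unit_p, TwoCell.map_one, wr_one]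
  have e₂ : wr (wr (map N.G R.unit) (N.app R.L)) (dom w R.cell) =
      wr (map N.G R.cell) (N.app B) := by
    rw [R.dom_cell, wr_wr, ← N.naturality R.tight_q, ← wr_wr, ← map_wr, R.unit_q]
  have e₃ : wl (dom w (wr (map N.G R.unit) (N.app R.L))) R.cell = wl (N.app R.L) R.cell := by
    rw [dom_wr, dom_map, R.dom_unit, N.G.map_id, Strict.id_comp]
  have e₄ : wl (cod w (wr (map N.G R.unit) (N.app R.L))) R.cell =
      wl (N.G.map R.p) (R.natCell N) := by
    rw [cod_wr, cod_map, R.cod_unit, N.G.map_comp, Strict.assoc, ← wl_wl, natCell]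
  rw [e₁, e₃] at h₁
  rw [e₂, e₄, h₁.eq_of_one_right] at h₂
  exact h₂

/-- The cone is the restriction of the limit cone along a tight `t`, and `N` is natural at `t`, so
`oComp_cell` whiskered by `N.G.map t` is the claim. Invertibility is needed only for the lift
through a pseudolimit. -/
theorem oComp_of_isIso {M : 𝔸.Obj} {p : M ⟶ A} {c : TwoCell M B} (hp : 𝔸.IsTight p)
    (hd : 𝔸.IsTight (dom w c)) (hc : cod w c = p ≫ f) (hi : w = .pseudo → IsIso c.hom) :
    OComp w (wr (map N.G c) (N.app B)) (wl (N.G.map p) (R.natCell N)) (wl (N.app M) c) := by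
  obtain ⟨t, ht, rfl, rfl⟩ := R.lift hp hd hc hi
  have h := (R.oComp_cell N).wl (N.G.map t)
  rw [← wr_wl, ← map_wl, wl_wl, wl_wl, ← N.G.map_comp, N.naturality ht, ← wl_wl] at h
  exact h

/-- A 2-cell from a tight morphism to `f` after a tight morphism is compatible with the naturality
2-cells of `N`. -/
theorem oComp_of_tight (R' : ∀ {A B : 𝔸.Obj} (f : A ⟶ B), 𝔸.Resolution w f) {M : 𝔸.Obj}
    {p : M ⟶ A} {c : TwoCell M B} (hp : 𝔸.IsTight p) (hd : 𝔸.IsTight (dom w c))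
    (hc : cod w c = p ≫ f) :
    OComp w (wr (map N.G c) (N.app B)) (wl (N.G.map p) (R.natCell N)) (wl (N.app M) c) := by
  by_cases hw : w = .pseudo
  · subst hw
    -- A non-invertible `c` does not factor through the pseudolimit of `f`. After restriction to the
    -- pseudolimit of `p ≫ f`, it can be compared with an invertible 2-cell having the same
    -- codomain.
    let S := R' (p ≫ f)
    have hSp := 𝔸.isTight_comp _ _ S.tight_p hp
    have hSd : 𝔸.IsTight (dom .pseudo S.cell) := by
      rw [S.dom_cell]
      exact S.tight_q
    have hSc : cod .pseudo S.cell = (S.p ≫ p) ≫ f := by rw [S.cod_cell, Strict.assoc]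
    -- The restriction of `c` is `κ` followed by the invertible `S.cell`. Both boundaries of `κ` are
    -- tight, so `N` is already 2-natural at `κ`, and only `S.cell` needs the previous lemma.
    obtain ⟨κ, hκ⟩ := exists_oComp_of_isIso (w := .pseudo) (c := wl S.p c) (S.isIso_cell rfl)
      (by rw [S.cod_cell, cod_wl, hc])
    have hκs : 𝔸.IsTight κ.src := by
      have h : S.p ≫ c.src = κ.src := hκ.dom_eq
      rw [← h]
      exact 𝔸.isTight_comp _ _ S.tight_p hd
    have hκt : 𝔸.IsTight κ.tgt := by
      have h : κ.tgt = S.cell.src := hκ.cod_eq_dom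
      rw [h]
      exact hSd
    have h₁ := hκ.wl (N.app S.L)
    rw [← N.naturality₂ hκs hκt] at h₁
    have h₂ := ((hκ.map N.G).wr (N.app B)).assoc
      (R.oComp_of_isIso N hSp hSd hSc S.isIso_cell) h₁
    -- Restriction along the section `S.r` cancels `S.p` and returns to `c`.
    have h₃ := h₂.wl (N.G.map S.r)
    rw [map_wl, wr_wl, wl_wl, S.map_r_map_p, id_wl, wl_wl, N.G.map_comp, ← Strict.assoc,
      S.map_r_map_p, Strict.id_comp, wl_wl, wl_wl, Strict.assoc, ← N.naturality S.tight_p, ← Strict.assoc,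
      S.map_r_map_p, Strict.id_comp] at h₃
    exact h₃
  · exact R.oComp_of_isIso N hp hd hc fun h => absurd h hw

variable (R : ∀ {A B : 𝔸.Obj} (f : A ⟶ B), 𝔸.Resolution w f)

/-- A tight `f` is itself the domain of an admissible cone, namely its identity with leg `𝟙 A`; the
pasting equation then reads `natCell = 1`. -/
theorem natCell_of_tight {f : A ⟶ B} (hf : 𝔸.IsTight f) :
    (R f).natCell N = one (N.app A ≫ f) := by
  have h := (R f).oComp_of_tight N R (c := one f) (𝔸.isTight_id A) (by simpa using hf)
    (by simp)
  rw [TwoCell.map_one, wr_one, wl_one, N.G.map_id, id_wl] at h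
  exact h.eq_of_one_left.symm

/-- In a resolution `f` becomes the tight `S.q`, but `S.q ≫ g` is again loose, so it is resolved in
turn. The iterated limit carries a 2-cell `c` from a tight morphism to `S'.p ≫ S.p ≫ f ≫ g`, built
from both limit 2-cells. Restricting the decomposition of `c` along the two sections expresses all
three naturality 2-cells. -/
theorem oComp_natCell (f : A ⟶ B) (g : B ⟶ C) :
    OComp w (wl (N.G.map f) ((R g).natCell N)) (wr ((R f).natCell N) g)
      ((R (f ≫ g)).natCell N) := by
  let S := R f
  let S' := R (S.q ≫ g)
  obtain ⟨c, hc⟩ := OComp.exists_of_eq (w := w) (a := S'.cell) (b := wl S'.p (wr S.cell g))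
    (by rw [S'.cod_cell, dom_wl, dom_wr, S.dom_cell])
  have hcd : dom w c = S'.q := by rw [hc.dom_eq, S'.dom_cell]
  have hS'd : 𝔸.IsTight (dom w S'.cell) := by
    rw [S'.dom_cell]
    exact S'.tight_q
  -- The pasting equation is used twice: for `f ≫ g` with `c`, and for `g` with `S'.cell`, where
  -- `S'.p ≫ S.q` is the tight leg.
  have h₁ := (R (f ≫ g)).oComp_of_tight N R (𝔸.isTight_comp _ _ S'.tight_p S.tight_p) (c := c)
    (by rw [hcd]; exact S'.tight_q) (by
      rw [hc.cod_eq, cod_wl, cod_wr, S.cod_cell]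
      simp only [Strict.assoc])
  have h₂ := (R g).oComp_of_tight N R (𝔸.isTight_comp _ _ S'.tight_p S.tight_q) (c := S'.cell)
    hS'd (by rw [S'.cod_cell, Strict.assoc])
  -- Each section trivialises its own limit 2-cell, so their composite trivialises `c`; this
  -- isolates the naturality 2-cell in `h₄`.
  have h₃ : wl (S.r ≫ S'.r) c = one (f ≫ g) := by
    have h := hc.wl (S.r ≫ S'.r)
    rw [← wl_wl, S'.r_cell, wl_one, wl_wl, Strict.assoc, S'.r_p, Strict.comp_id, ← wr_wl,
      S.r_cell, wr_one] at h
    rw [h.eq_of_one_left]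
  have h₄ : (R (f ≫ g)).natCell N = wl (N.G.map (S.r ≫ S'.r) ≫ N.app S'.L) c := by
    have h := h₁.wl (N.G.map (S.r ≫ S'.r))
    rw [← wr_wl, ← map_wl, h₃, TwoCell.map_one, wr_one, wl_wl, wl_wl, ← N.G.map_comp, Strict.assoc,
      ← Strict.assoc S'.r, S'.r_p, Strict.id_comp, S.r_p, N.G.map_id, id_wl] at h
    exact h.eq_of_one_left.symm
  have h₅ : wl (N.G.map (S.r ≫ S'.r) ≫ N.app S'.L) S'.cell =
      wl (N.G.map f) ((R g).natCell N) := by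
    have h := h₂.wl (N.G.map (S.r ≫ S'.r))
    rw [← wr_wl, ← map_wl, ← wl_wl S.r, S'.r_cell, wl_one, TwoCell.map_one, wr_one, wl_wl, wl_wl,
      ← N.G.map_comp, Strict.assoc, ← Strict.assoc S'.r, S'.r_p, Strict.id_comp, S.r_q] at h
    exact h.eq_of_one_left
  -- Whiskering the definition of `c` turns its first factor into the 2-cell of `g` by `h₅`, and its
  -- second into that of `f`, since naturality at the tight `S'.p` removes `S'.r`.
  have h₆ := hc.wl (N.G.map (S.r ≫ S'.r) ≫ N.app S'.L)
  rw [h₅, ← h₄, wl_wl, Strict.assoc, ← N.naturality S'.tight_p, ← Strict.assoc, ← N.G.map_comp,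
    Strict.assoc, S'.r_p, Strict.comp_id, ← wr_wl] at h₆
  exact h₆

theorem natCell_comp_of_tight {f : A ⟶ B} (hf : 𝔸.IsTight f) (g : B ⟶ C) :
    (R (f ≫ g)).natCell N = wl (N.G.map f) ((R g).natCell N) := by
  have h := oComp_natCell N R f g
  rw [natCell_of_tight N R hf, wr_one] at h
  exact h.eq_of_one_right

/-- The limit 2-cell of the domain of `a`, followed by `a`, is a 2-cell from the tight `S.q` to the
codomain of `a` after `S.p`. The pasting equation for it, restricted along the section, is the
claim. In the pseudo case `a` is arbitrary, so the non-invertible form of `oComp_of_tight` is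
essential here. -/
theorem exists_oComp_natCell (a : TwoCell A B) :
    ∃ c, OComp w ((R (dom w a)).natCell N) (wl (N.app A) a) c ∧
      OComp w (wr (map N.G a) (N.app B)) ((R (cod w a)).natCell N) c := by
  let S := R (dom w a)
  obtain ⟨c, hc⟩ := OComp.exists_of_eq (w := w) (a := S.cell) (b := wl S.p a)
    (by rw [S.cod_cell, dom_wl])
  have hr : wl S.r c = a := by
    have h := hc.wl S.r
    rw [S.r_cell, wl_wl, S.r_p, id_wl] at h
    exact h.eq_of_one_left
  have h₁ := ((R (cod w a)).oComp_of_tight N R S.tight_p (c := c)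
    (by rw [hc.dom_eq, S.dom_cell]; exact S.tight_q) (by rw [hc.cod_eq, cod_wl])).wl
      (N.G.map S.r)
  rw [← wr_wl, ← map_wl, hr, wl_wl, S.map_r_map_p, id_wl] at h₁
  refine ⟨_, ?_, h₁⟩
  have h₂ := hc.wl (N.G.map S.r ≫ N.app S.L)
  rw [wl_wl, Strict.assoc, ← N.naturality S.tight_p, ← Strict.assoc, S.map_r_map_p,
    Strict.id_comp, ← wl_wl _ _ c] at h₂
  exact h₂

/-- The multiplication law before `H` is applied: compatibility of the naturality 2-cells with the
2-cell `(R f).natCell N` itself. Its domain is tight, so one term is an identity; its codomain is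
`f` after a tight morphism, so the other is a whiskering. -/
theorem oComp_map_natCell (f : A ⟶ B) :
    OComp w (wr (map N.G ((R f).natCell N)) (N.app B))
      (wl (N.G.map (N.app A)) ((R f).natCell N))
      (wl (N.app (N.G.obj A)) ((R f).natCell N)) := by
  obtain ⟨c, h₁, h₂⟩ := exists_oComp_natCell N R ((R f).natCell N)
  rw [dom_natCell, natCell_of_tight N R (𝔸.isTight_comp _ _ (N.tight_map f) (N.tight_app B))] at h₁
  rw [cod_natCell, natCell_comp_of_tight N R (N.tight_app A), h₁.eq_of_one_left] at h₂
  exact h₂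

end Resolution

end FCategory

/-! ### Extensionality of 2-functors and `F`-functors, and transport lemmas. -/

namespace CategoryTheory.StrictPseudofunctor

variable {B : Type u₁} [Bicategory.{w₁, v₁} B] {C : Type u₂} [Bicategory.{w₂, v₂} C]

/-- Strictness determines the coherence isomorphisms: both are `eqToIso`s, so they agree as soon as
the values on cells do. -/
theorem ext_of_heq {F G : StrictPseudofunctor B C} (hobj : ∀ X, F.obj X = G.obj X)
    (hmap : ∀ {X Y : B} (f : X ⟶ Y), F.map f ≍ G.map f)
    (hmap₂ : ∀ {X Y : B} {f g : X ⟶ Y} (α : f ⟶ g), F.map₂ α ≍ G.map₂ α) : F = G := by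
  obtain ⟨⟨⟨⟨⟨⟨obj, map⟩, map₂⟩, _, _⟩, mapId, mapComp, _, _, _, _, _⟩, _, hid⟩, _, hcomp⟩ := F
  obtain ⟨⟨⟨⟨⟨⟨obj', map'⟩, map₂'⟩, _, _⟩, mapId', mapComp', _, _, _, _, _⟩, _, hid'⟩, _, hcomp'⟩ := G
  obtain rfl : obj = obj' := funext hobj
  obtain rfl : @map = @map' := by
    funext X Y f
    exact eq_of_heq (hmap f)
  obtain rfl : @map₂ = @map₂' := by
    funext X Y f g α
    exact eq_of_heq (hmap₂ α)
  obtain rfl : mapId = mapId' := by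
    funext X
    exact (hid X).trans (hid' X).symm
  obtain rfl : @mapComp = @mapComp' := by
    funext X Y Z f g
    exact (hcomp f g).trans (hcomp' f g).symm
  rfl

/-- Tightness is a property, and 2-cells between tight morphisms are all 2-cells, so the inclusion
loses nothing. This transfers the pseudo case from the lax one. -/
theorem comp_tightInclusion_injective {𝔸 : FCategory.{w, v, u}}
    {F G : StrictPseudofunctor B 𝔸.Tight}
    (h : F.comp 𝔸.tightInclusion = G.comp 𝔸.tightInclusion) : F = G := by
  have hobj : ∀ X, F.obj X = G.obj X := fun X =>
    FCategory.Tight.ext (congrArg (fun E => E.obj X) h)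
  have hmap₀ {X Y : B} (f : X ⟶ Y) : (F.map f).hom ≍ (G.map f).hom := by
    change (F.comp 𝔸.tightInclusion).map f ≍ (G.comp 𝔸.tightInclusion).map f
    rw [h]
  have hmap {X Y : B} (f : X ⟶ Y) : F.map f ≍ G.map f := by
    have h' := hmap₀ f
    revert h'
    generalize F.map f = a
    generalize G.map f = b
    revert a
    rw [hobj X, hobj Y]
    exact fun a h => heq_of_eq (FCategory.TightHom.ext (eq_of_heq h))
  refine ext_of_heq hobj hmap fun {X Y f g} α => ?_
  have h' : (F.map₂ α).hom ≍ (G.map₂ α).hom := by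
    change (F.comp 𝔸.tightInclusion).map₂ α ≍ (G.comp 𝔸.tightInclusion).map₂ α
    rw [h]
  have hf := hmap f
  have hg := hmap g
  revert h' hf hg
  generalize F.map₂ α = a
  generalize G.map₂ α = b
  revert a b
  generalize F.map f = x
  generalize F.map g = y
  generalize G.map f = z
  generalize G.map g = t
  revert x y
  rw [hobj X, hobj Y]
  intro x y a b h hf hg
  cases hf
  cases hg
  exact heq_of_eq (FCategory.TightHom₂.ext (eq_of_heq h))

end CategoryTheory.StrictPseudofunctor

theorem FFunctor.ext_toStrictPseudofunctor {𝔸 : FCategory.{w₁, v₁, u₁}}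
    {𝔹 : FCategory.{w₂, v₂, u₂}} {F G : FFunctor 𝔸 𝔹}
    (h : F.toStrictPseudofunctor = G.toStrictPseudofunctor) : F = G := by
  obtain ⟨F, _⟩ := F
  obtain ⟨G, _⟩ := G
  cases h
  rfl

theorem TwoCell.map_heq_of_eq {B : Type u₁} [Bicategory.{w₁, v₁} B] {C : Type u₂}
    [Bicategory.{w₂, v₂} C] {F G : StrictPseudofunctor B C} (h : F = G) {X Y : B}
    (a : TwoCell X Y) : TwoCell.map F a ≍ TwoCell.map G a := by
  rw [h]

theorem TwoCell.isIso_cast {K : Type u} [Bicategory.{w, v} K] {X Y : K} {f g : X ⟶ Y}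
    {a : TwoCell X Y} (hf : a.src = f) (hg : a.tgt = g) (ha : IsIso a.hom) :
    IsIso (eqToHom hf.symm ≫ a.hom ≫ eqToHom hg) := by
  subst hf hg
  rwa [eqToHom_refl, eqToHom_refl, Category.id_comp, Category.comp_id]

theorem TwoNatTrans.naturality_cell {B : Type u₁} [Bicategory.{w₁, v₁} B] {C : Type u₂}
    [Bicategory.{w₂, v₂} C] {F G : StrictPseudofunctor B C} (t : TwoNatTrans F G) {X Y : B}
    (a : TwoCell X Y) :
    wr (TwoCell.map F a) (t.app Y) = wl (t.app X) (TwoCell.map G a) := by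
  have h := mk_inj_iff.2 (t.naturality₂ a.hom)
  simpa using h

/-! ### Morphisms of algebras and their 2-cells in terms of bundled 2-cells. -/

namespace TwoMonad

variable {C : Type u} [Bicategory.{w, v} C] [Bicategory.Strict C] {M : TwoMonad C}
  {X Y Z : M.Algebra}

namespace LaxMor

/-- A lax morphism given by a bundled 2-cell. -/
def ofTwoCell (f : X.carrier ⟶ Y.carrier) (c : TwoCell (M.T.obj X.carrier) Y.carrier)
    (hd : c.src = M.T.map f ≫ Y.str) (hc : c.tgt = X.str ≫ f)
    (unit : wl (M.one X.carrier) c = TwoCell.one f)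
    (mult : OComp .lax (wr (TwoCell.map M.T c) Y.str) (wl (M.T.map X.str) c)
      (wl (M.mul X.carrier) c)) : LaxMor X Y where
  hom := f
  cell := eqToHom hd.symm ≫ c.hom ≫ eqToHom hc
  unit := mk_inj_iff.1 (by
    rw [mk_whiskerLeft, mk_cast hd hc, unit, mk_eqToHom, Algebra.one_str_comp])
  mult := by
    have h := VComp.mk_eqToHom (M.T.map₂ (eqToHom hd.symm ≫ c.hom ≫ eqToHom hc) ▷ Y.str)
      (Algebra.map_str_comp f) (M.T.map X.str ◁ (eqToHom hd.symm ≫ c.hom ≫ eqToHom hc))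
      (Algebra.mul_str_comp f)
    rw [mk_whiskerLeft, mk_whiskerRight, mk_map₂, mk_cast hd hc] at h
    rw [← mk_inj_iff, mk_eqToHom_comp, mk_whiskerLeft, mk_cast hd hc]
    exact VComp.unique mult h

theorem mk_cell_ofTwoCell (f : X.carrier ⟶ Y.carrier)
    (c : TwoCell (M.T.obj X.carrier) Y.carrier) (hd hc unit mult) :
    TwoCell.mk (ofTwoCell f c hd hc unit mult).cell = c :=
  mk_cast hd hc

theorem ext_cell {f g : LaxMor X Y} (h : f.hom = g.hom)
    (hc : TwoCell.mk f.cell = TwoCell.mk g.cell) : f = g := by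
  obtain ⟨f, c, _, _⟩ := f
  obtain ⟨g, d, _, _⟩ := g
  dsimp only at h hc
  subst h
  cases mk_inj_iff.1 hc
  rfl

/-- Equality with a bundled identity already contains the equation of 1-cells that strictness asks
for. -/
theorem isStrict_iff {f : LaxMor X Y} :
    f.IsStrict ↔ TwoCell.mk f.cell = TwoCell.one (X.str ≫ f.hom) := by
  constructor
  · rintro ⟨h, hc⟩
    rw [hc, mk_eqToHom]
  · intro h
    have h' : M.T.map f.hom ≫ Y.str = X.str ≫ f.hom := congrArg TwoCell.src h
    refine ⟨h', mk_inj_iff.1 ?_⟩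
    rw [h, mk_eqToHom]

/-- The underlying 1-cells are allowed to be only propositionally `f₀` and `g₀`; in the uniqueness
proof they are known to equal values of `H` but are not so by definition. -/
theorem oComp_comp {f : LaxMor X Y} {g : LaxMor Y Z} {f₀ : X.carrier ⟶ Y.carrier}
    {g₀ : Y.carrier ⟶ Z.carrier} (hf : f.hom = f₀) (hg : g.hom = g₀)
    {cf : TwoCell (M.T.obj X.carrier) Y.carrier} {cg : TwoCell (M.T.obj Y.carrier) Z.carrier}
    (hcf : TwoCell.mk f.cell = cf) (hcg : TwoCell.mk g.cell = cg) :
    OComp .lax (wl (M.T.map f₀) cg) (wr cf g₀) ⟨(f.comp g).cell⟩ := by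
  subst hf hg hcf hcg
  have h := VComp.mk_eqToHom (M.T.map f.hom ◁ g.cell) (Bicategory.Strict.assoc _ _ _).symm
    (f.cell ▷ g.hom) (Bicategory.Strict.assoc _ _ _)
  change VComp _ _ (TwoCell.mk (compCell f.cell g.cell))
  rw [compCell, mk_eqToHom_comp]
  exact h

end LaxMor

theorem LaxMor₂.oComp {f g : LaxMor X Y} {α : LaxMor₂ f g}
    {a : TwoCell X.carrier Y.carrier} (ha : TwoCell.mk α.hom = a) :
    ∃ c, OComp .lax ⟨f.cell⟩ (wl X.str a) c ∧
      OComp .lax (wr (TwoCell.map M.T a) Y.str) ⟨g.cell⟩ c := by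
  subst ha
  refine ⟨_, VComp.mk f.cell (X.str ◁ α.hom), ?_⟩
  rw [α.comm]
  exact .mk _ _

theorem LaxMor₂.comm_of_oComp {f g : LaxMor X Y} {α : f.hom ⟶ g.hom}
    {cf cg : TwoCell (M.T.obj X.carrier) Y.carrier} (hcf : TwoCell.mk f.cell = cf)
    (hcg : TwoCell.mk g.cell = cg)
    (h : ∃ c, OComp .lax cf (wl X.str ⟨α⟩) c ∧
      OComp .lax (wr (TwoCell.map M.T ⟨α⟩) Y.str) cg c) :
    f.cell ≫ X.str ◁ α = M.T.map₂ α ▷ Y.str ≫ g.cell := by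
  subst hcf hcg
  obtain ⟨c, h₁, h₂⟩ := h
  exact mk_inj_iff.1 ((VComp.unique (VComp.mk _ _) h₁).trans (VComp.unique h₂ (VComp.mk _ _)))

theorem LaxMor₂.heq_of_mk_hom_eq {f g f' g' : LaxMor X Y} (hf : f = f') (hg : g = g')
    {α : LaxMor₂ f g} {α' : LaxMor₂ f' g'} (h : TwoCell.mk α.hom = TwoCell.mk α'.hom) :
    α ≍ α' := by
  subst hf hg
  exact heq_of_eq (LaxMor₂.ext (mk_inj_iff.1 h))

end TwoMonad

namespace TwoMonad

variable {C : Type u} [Bicategory.{w, v} C] [Bicategory.Strict C] {M : TwoMonad C}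
  {X Y Z : M.Algebra}

namespace ColaxMor

/-- A colax morphism given by a bundled 2-cell. -/
def ofTwoCell (f : X.carrier ⟶ Y.carrier) (c : TwoCell (M.T.obj X.carrier) Y.carrier)
    (hd : c.src = X.str ≫ f) (hc : c.tgt = M.T.map f ≫ Y.str)
    (unit : wl (M.one X.carrier) c = TwoCell.one f)
    (mult : OComp .colax (wr (TwoCell.map M.T c) Y.str) (wl (M.T.map X.str) c)
      (wl (M.mul X.carrier) c)) : ColaxMor X Y where
  hom := f
  cell := eqToHom hd.symm ≫ c.hom ≫ eqToHom hc
  unit := mk_inj_iff.1 (by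
    rw [mk_whiskerLeft, mk_cast hd hc, unit, mk_eqToHom, Algebra.one_comp])
  mult := by
    have h := VComp.mk_eqToHom (M.T.map X.str ◁ (eqToHom hd.symm ≫ c.hom ≫ eqToHom hc))
      (Algebra.map_str_comp f).symm (M.T.map₂ (eqToHom hd.symm ≫ c.hom ≫ eqToHom hc) ▷ Y.str)
      (Algebra.mul_map_comp f).symm
    rw [mk_whiskerLeft, mk_whiskerRight, mk_map₂, mk_cast hd hc] at h
    rw [← mk_inj_iff, mk_eqToHom_comp, mk_whiskerLeft, mk_cast hd hc]
    exact VComp.unique mult h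

theorem mk_cell_ofTwoCell (f : X.carrier ⟶ Y.carrier)
    (c : TwoCell (M.T.obj X.carrier) Y.carrier) (hd hc unit mult) :
    TwoCell.mk (ofTwoCell f c hd hc unit mult).cell = c :=
  mk_cast hd hc

theorem ext_cell {f g : ColaxMor X Y} (h : f.hom = g.hom)
    (hc : TwoCell.mk f.cell = TwoCell.mk g.cell) : f = g := by
  obtain ⟨f, c, _, _⟩ := f
  obtain ⟨g, d, _, _⟩ := g
  dsimp only at h hc
  subst h
  cases mk_inj_iff.1 hc
  rfl

theorem isStrict_iff {f : ColaxMor X Y} :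
    f.IsStrict ↔ TwoCell.mk f.cell = TwoCell.one (X.str ≫ f.hom) := by
  constructor
  · rintro ⟨h, hc⟩
    rw [hc, mk_eqToHom, h]
  · intro h
    have h' : M.T.map f.hom ≫ Y.str = X.str ≫ f.hom := congrArg TwoCell.tgt h
    refine ⟨h'.symm, mk_inj_iff.1 ?_⟩
    rw [h, mk_eqToHom, h']

theorem oComp_comp {f : ColaxMor X Y} {g : ColaxMor Y Z} {f₀ : X.carrier ⟶ Y.carrier}
    {g₀ : Y.carrier ⟶ Z.carrier} (hf : f.hom = f₀) (hg : g.hom = g₀)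
    {cf : TwoCell (M.T.obj X.carrier) Y.carrier} {cg : TwoCell (M.T.obj Y.carrier) Z.carrier}
    (hcf : TwoCell.mk f.cell = cf) (hcg : TwoCell.mk g.cell = cg) :
    OComp .colax (wl (M.T.map f₀) cg) (wr cf g₀) ⟨(f.comp g).cell⟩ := by
  subst hf hg hcf hcg
  have h := VComp.mk_eqToHom (f.cell ▷ g.hom) (Bicategory.Strict.assoc _ _ _)
    (M.T.map f.hom ◁ g.cell) (show _ = M.T.map (f.hom ≫ g.hom) ≫ Z.str by
      rw [M.T.map_comp, Bicategory.Strict.assoc])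
  change VComp _ _ (TwoCell.mk (compCell f.cell g.cell))
  rw [compCell, mk_eqToHom_comp]
  exact h

end ColaxMor

/-- Compared with the lax version `f` and `g` trade places, because for `.colax` the oriented domain
of a 2-cell is its target. -/
theorem ColaxMor₂.oComp {f g : ColaxMor X Y} {α : ColaxMor₂ f g}
    {a : TwoCell X.carrier Y.carrier} (ha : TwoCell.mk α.hom = a) :
    ∃ c, OComp .colax ⟨g.cell⟩ (wl X.str a) c ∧
      OComp .colax (wr (TwoCell.map M.T a) Y.str) ⟨f.cell⟩ c := by
  subst ha
  refine ⟨_, VComp.mk (X.str ◁ α.hom) g.cell, ?_⟩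
  rw [← α.comm]
  exact .mk _ _

theorem ColaxMor₂.comm_of_oComp {f g : ColaxMor X Y} {α : f.hom ⟶ g.hom}
    {cf cg : TwoCell (M.T.obj X.carrier) Y.carrier} (hcf : TwoCell.mk f.cell = cf)
    (hcg : TwoCell.mk g.cell = cg)
    (h : ∃ c, OComp .colax cg (wl X.str ⟨α⟩) c ∧
      OComp .colax (wr (TwoCell.map M.T ⟨α⟩) Y.str) cf c) :
    f.cell ≫ M.T.map₂ α ▷ Y.str = X.str ◁ α ≫ g.cell := by
  subst hcf hcg
  obtain ⟨c, h₁, h₂⟩ := h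
  exact mk_inj_iff.1 ((VComp.unique (VComp.mk _ _) h₂).trans (VComp.unique h₁ (VComp.mk _ _)))

theorem ColaxMor₂.heq_of_mk_hom_eq {f g f' g' : ColaxMor X Y} (hf : f = f') (hg : g = g')
    {α : ColaxMor₂ f g} {α' : ColaxMor₂ f' g'} (h : TwoCell.mk α.hom = TwoCell.mk α'.hom) :
    α ≍ α' := by
  subst hf hg
  exact heq_of_eq (ColaxMor₂.ext (mk_inj_iff.1 h))

end TwoMonad

/-! ### Structure 2-cells over `H`: algebra axioms and uniqueness. -/

namespace FCategory

variable {𝔸 : FCategory.{w₁, v₁, u₁}} {B : Type u₂} [Bicategory.{w₂, v₂} B]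

namespace TightCounit

variable (N : 𝔸.TightCounit) (H : StrictPseudofunctor 𝔸.Obj B)

/-- A family of 2-cells extending the 2-naturality of `H N` to the loose morphisms. -/
structure IsNatural (w : Weakness)
    (k : ∀ {X Y : 𝔸.Obj}, (X ⟶ Y) → TwoCell (H.obj (N.G.obj X)) (H.obj Y)) : Prop where
  of_tight : ∀ {X Y : 𝔸.Obj} {f : X ⟶ Y}, 𝔸.IsTight f → k f = one (H.map (N.app X) ≫ H.map f)
  comp : ∀ {X Y Z : 𝔸.Obj} (f : X ⟶ Y) (g : Y ⟶ Z),
    OComp w (wl (H.map (N.G.map f)) (k g)) (wr (k f) (H.map g)) (k (f ≫ g))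
  cell : ∀ {X Y : 𝔸.Obj} (a : TwoCell X Y), ∃ c,
    OComp w (k (dom w a)) (wl (H.map (N.app X)) (TwoCell.map H a)) c ∧
    OComp w (wr (TwoCell.map H (TwoCell.map N.G a)) (H.map (N.app Y))) (k (cod w a)) c

end TightCounit

namespace Resolution

variable {w : Weakness} (R : ∀ {X Y : 𝔸.Obj} (f : X ⟶ Y), 𝔸.Resolution w f)
  (N : 𝔸.TightCounit) (H : StrictPseudofunctor 𝔸.Obj B)

/-- The image under `H` of the naturality 2-cell of `N` at a loose morphism. -/
def structureCell {X Y : 𝔸.Obj} (f : X ⟶ Y) : TwoCell (H.obj (N.G.obj X)) (H.obj Y) :=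
  TwoCell.map H ((R f).natCell N)

theorem isNatural_structureCell : N.IsNatural H w (structureCell R N H) where
  of_tight hf := by
    rw [structureCell, natCell_of_tight _ R hf, TwoCell.map_one, H.map_comp]
  comp f g := by
    have h := (oComp_natCell N R f g).map H
    rwa [map_wl, map_wr] at h
  cell a := by
    obtain ⟨c, h₁, h₂⟩ := exists_oComp_natCell N R a
    have h₁ := h₁.map H
    have h₂ := h₂.map H
    rw [map_wl] at h₁
    rw [map_wr] at h₂
    exact ⟨_, h₁, h₂⟩

variable {X Y : 𝔸.Obj} (f : X ⟶ Y)

theorem dom_structureCell :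
    dom w (structureCell R N H f) = H.map (N.G.map f) ≫ H.map (N.app Y) := by
  rw [structureCell, dom_map, dom_natCell, H.map_comp]

theorem cod_structureCell :
    cod w (structureCell R N H f) = H.map (N.app X) ≫ H.map f := by
  rw [structureCell, cod_map, cod_natCell, H.map_comp]

theorem isIso_structureCell (hw : w = .pseudo) : IsIso (structureCell R N H f).hom := by
  have := (R f).isIso_cell hw
  exact inferInstanceAs (IsIso (H.map₂ ((N.G.map (R f).r ≫ N.app (R f).L) ◁ (R f).cell.hom)))

/-- Naturality of `η` moves it past the section, a triangle identity cancels it against the counit,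
and what remains is the image of the limit 2-cell restricted along its section. -/
theorem wl_unit_structureCell [Bicategory.Strict B]
    (η : ∀ X : 𝔸.Obj, H.obj X ⟶ H.obj (N.G.obj X))
    (hη : ∀ {X Y : 𝔸.Obj} (f : X ⟶ Y), H.map f ≫ η Y = η X ≫ H.map (N.G.map f))
    (hη' : ∀ X : 𝔸.Obj, η X ≫ H.map (N.app X) = 𝟙 (H.obj X)) :
    wl (η X) (structureCell R N H f) = one (H.map f) := by
  rw [structureCell, natCell, map_wl, wl_wl, H.map_comp, ← Strict.assoc, ← hη, Strict.assoc, hη',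
    Strict.comp_id, ← map_wl, (R f).r_cell, TwoCell.map_one]

theorem oComp_map_structureCell :
    OComp w (wr (TwoCell.map H (TwoCell.map N.G ((R f).natCell N))) (H.map (N.app Y)))
      (wl (H.map (N.G.map (N.app X))) (structureCell R N H f))
      (wl (H.map (N.app (N.G.obj X))) (structureCell R N H f)) := by
  have h := (oComp_map_natCell N R f).map H
  rwa [map_wl, map_wl, map_wr] at h

/-- Compatibility with the limit 2-cell `q ⇒ f p` determines `k f`: `k` is an identity at the tight
`q`, and at `p ≫ f` it is `k f` whiskered by the image of `p`. Restriction along the section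
isolates `k f`. No unit or multiplication law enters. -/
theorem _root_.FCategory.TightCounit.IsNatural.eq_structureCell [Bicategory.Strict B]
    {k : ∀ {X Y : 𝔸.Obj}, (X ⟶ Y) → TwoCell (H.obj (N.G.obj X)) (H.obj Y)}
    (hk : N.IsNatural H w k) : k f = structureCell R N H f := by
  obtain ⟨c, h₁, h₂⟩ := hk.cell (R f).cell
  rw [hk.of_tight (by rw [(R f).dom_cell]; exact (R f).tight_q)] at h₁
  rw [(R f).cod_cell, h₁.eq_of_one_left] at h₂
  have h₃ := hk.comp (R f).p f
  rw [hk.of_tight (R f).tight_p, wr_one] at h₃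
  rw [h₃.eq_of_one_right] at h₂
  have h₄ := h₂.wl (H.map (N.G.map (R f).r))
  rw [← wr_wl, ← map_wl, ← map_wl, (R f).r_cell, TwoCell.map_one, TwoCell.map_one, wr_one,
    wl_wl, ← H.map_comp (N.G.map (R f).r), (R f).map_r_map_p, H.map_id, id_wl, wl_wl] at h₄
  rw [← h₄.eq_of_one_left, structureCell, natCell, map_wl, H.map_comp]

end Resolution

end FCategory

/-! ### Specialisation to the counit and monad of the adjunction. -/

namespace TwoAdjunction

variable {𝔸 : FCategory.{w₁, v₁, u₁}} {B : Type u₂} [Bicategory.{w₂, v₂} B] [Bicategory.Strict B]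
  {H : FFunctor 𝔸 (FCategory.ofTwoCategory B)} {F : StrictPseudofunctor B 𝔸.Tight}
  (adj : TwoAdjunction F H.tightPart)

/-- The counit of a left 2-adjoint of the tight part of an `F`-functor. -/
def tightCounit : 𝔸.TightCounit where
  G := H.toStrictPseudofunctor.comp (F.comp 𝔸.tightInclusion)
  tight_map f := (F.map (H.map f)).tight
  app A := (adj.counit.app ⟨A⟩).hom
  tight_app A := (adj.counit.app ⟨A⟩).tight
  naturality {A B f} hf := congrArg FCategory.TightHom.hom
    (adj.counit.naturality (X := ⟨A⟩) (Y := ⟨B⟩) ⟨f, hf⟩)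
  naturality₂ {A B a} hs ht := by
    -- A 2-cell with tight boundary is a 2-cell of `𝔸.Tight`, where the counit is 2-natural.
    let f : (⟨A⟩ : 𝔸.Tight) ⟶ ⟨B⟩ := ⟨a.src, hs⟩
    let g : (⟨A⟩ : 𝔸.Tight) ⟶ ⟨B⟩ := ⟨a.tgt, ht⟩
    let α : f ⟶ g := ⟨a.hom⟩
    have h := congrArg (TwoCell.map 𝔸.tightInclusion) (adj.counit.naturality_cell ⟨α⟩)
    rw [map_wr, map_wl] at h
    exact h

/-- The algebra `(H A, H ε_A)`. -/
abbrev comparisonAlgebra (A : 𝔸.Obj) : adj.monad.Algebra := (adj.comparison.obj ⟨A⟩).alg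

variable {w : Weakness}

theorem unit_naturality_map {X Y : 𝔸.Obj} (f : X ⟶ Y) :
    H.map f ≫ adj.monad.one (H.obj Y) =
      adj.monad.one (H.obj X) ≫ H.map (adj.tightCounit.G.map f) :=
  adj.unit.naturality (H.map f)

/-- The 2-cells of a functorial family of oriented `w`-morphisms of algebras over the values of `H`,
which are the unique family extending the identities at the tight morphisms. -/
structure StructureCells (w : Weakness) where
  cell : ∀ {X Y : 𝔸.Obj}, (X ⟶ Y) → TwoCell (adj.monad.T.obj (adj.comparisonAlgebra X).carrier)
    (adj.comparisonAlgebra Y).carrier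
  isNatural : adj.tightCounit.IsNatural H.toStrictPseudofunctor w cell
  dom_cell : ∀ {X Y : 𝔸.Obj} (f : X ⟶ Y),
    dom w (cell f) = adj.monad.T.map (H.map f) ≫ (adj.comparisonAlgebra Y).str
  cod_cell : ∀ {X Y : 𝔸.Obj} (f : X ⟶ Y),
    cod w (cell f) = (adj.comparisonAlgebra X).str ≫ H.map f
  wl_one_cell : ∀ {X Y : 𝔸.Obj} (f : X ⟶ Y),
    wl (adj.monad.one (adj.comparisonAlgebra X).carrier) (cell f) = TwoCell.one (H.map f)
  oComp_map_cell : ∀ {X Y : 𝔸.Obj} (f : X ⟶ Y),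
    OComp w (wr (TwoCell.map adj.monad.T (cell f)) (adj.comparisonAlgebra Y).str)
      (wl (adj.monad.T.map (adj.comparisonAlgebra X).str) (cell f))
      (wl (adj.monad.mul (adj.comparisonAlgebra X).carrier) (cell f))
  eq_cell : ∀ {k : ∀ {X Y : 𝔸.Obj}, (X ⟶ Y) →
      TwoCell (adj.monad.T.obj (adj.comparisonAlgebra X).carrier)
        (adj.comparisonAlgebra Y).carrier},
    adj.tightCounit.IsNatural H.toStrictPseudofunctor w k →
      ∀ {X Y : 𝔸.Obj} (f : X ⟶ Y), k f = cell f
  isIso_cell : w = .pseudo → ∀ {X Y : 𝔸.Obj} (f : X ⟶ Y), IsIso (cell f).hom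

/-- The structure 2-cells obtained from resolutions of the loose morphisms. -/
def structureCells (R : ∀ {X Y : 𝔸.Obj} (f : X ⟶ Y), 𝔸.Resolution w f) :
    adj.StructureCells w where
  cell := FCategory.Resolution.structureCell R adj.tightCounit H.toStrictPseudofunctor
  isNatural :=
    FCategory.Resolution.isNatural_structureCell R adj.tightCounit H.toStrictPseudofunctor
  dom_cell := FCategory.Resolution.dom_structureCell R adj.tightCounit H.toStrictPseudofunctor
  cod_cell := FCategory.Resolution.cod_structureCell R adj.tightCounit H.toStrictPseudofunctor
  wl_one_cell f := FCategory.Resolution.wl_unit_structureCell R adj.tightCounit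
    H.toStrictPseudofunctor f (fun X => adj.monad.one (H.obj X)) adj.unit_naturality_map
    fun X => adj.right_triangle ⟨X⟩
  oComp_map_cell :=
    FCategory.Resolution.oComp_map_structureCell R adj.tightCounit H.toStrictPseudofunctor
  eq_cell hk _ _ f := hk.eq_structureCell R adj.tightCounit H.toStrictPseudofunctor f
  isIso_cell hw _ _ f :=
    FCategory.Resolution.isIso_structureCell R adj.tightCounit H.toStrictPseudofunctor f hw

variable {adj}

/-- Structure 2-cells of pseudomorphisms are structure 2-cells of lax morphisms. -/
def StructureCells.toLax (S : adj.StructureCells .pseudo) : adj.StructureCells .lax where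
  cell := S.cell
  isNatural := ⟨S.isNatural.of_tight, S.isNatural.comp, S.isNatural.cell⟩
  dom_cell := S.dom_cell
  cod_cell := S.cod_cell
  wl_one_cell := S.wl_one_cell
  oComp_map_cell := S.oComp_map_cell
  eq_cell hk _ _ f := S.eq_cell ⟨hk.of_tight, hk.comp, hk.cell⟩ f
  isIso_cell := nofun

end TwoAdjunction

/-! ### The extended comparison 2-functors and their uniqueness. -/

namespace TwoAdjunction

variable {𝔸 : FCategory.{w₁, v₁, u₁}} {B : Type u₂} [Bicategory.{w₂, v₂} B] [Bicategory.Strict B]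
  {H : FFunctor 𝔸 (FCategory.ofTwoCategory B)} {F : StrictPseudofunctor B 𝔸.Tight}
  (adj : TwoAdjunction F H.tightPart)

section Lax

variable {adj} (S : adj.StructureCells .lax)

/-- The lax morphism of algebras over the value of `H` at a loose morphism. -/
def StructureCells.laxMap {X Y : 𝔸.Obj} (f : X ⟶ Y) :
    TwoMonad.LaxMor (adj.comparisonAlgebra X) (adj.comparisonAlgebra Y) :=
  .ofTwoCell (H.map f) (S.cell f)
    (S.dom_cell f)
    (S.cod_cell f)
    (S.wl_one_cell f) (S.oComp_map_cell f)

theorem StructureCells.mk_cell_laxMap {X Y : 𝔸.Obj} (f : X ⟶ Y) :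
    TwoCell.mk (S.laxMap f).cell = S.cell f :=
  TwoMonad.LaxMor.mk_cell_ofTwoCell ..

theorem StructureCells.mk_cell_laxMap_of_tight {X Y : 𝔸.Obj} {f : X ⟶ Y} (hf : 𝔸.IsTight f) :
    TwoCell.mk (S.laxMap f).cell = TwoCell.one ((adj.comparisonAlgebra X).str ≫ H.map f) :=
  (S.mk_cell_laxMap f).trans
    (S.isNatural.of_tight hf)

/-- The 2-cell of lax morphisms of algebras over the value of `H` at a 2-cell. -/
def StructureCells.laxMap₂ {X Y : 𝔸.Obj} {f g : X ⟶ Y} (α : f ⟶ g) :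
    TwoMonad.LaxMor₂ (S.laxMap f) (S.laxMap g) where
  hom := H.map₂ α
  comm := TwoMonad.LaxMor₂.comm_of_oComp (S.mk_cell_laxMap f) (S.mk_cell_laxMap g)
    (S.isNatural.cell ⟨α⟩)

theorem StructureCells.laxMap_id (X : 𝔸.Obj) : S.laxMap (𝟙 X) = TwoMonad.LaxMor.id _ :=
  TwoMonad.LaxMor.ext_cell (H.map_id X) ((S.mk_cell_laxMap_of_tight (𝔸.isTight_id X)).trans
    ((congrArg (fun a => TwoCell.one ((adj.comparisonAlgebra X).str ≫ a)) (H.map_id X)).trans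
      (TwoMonad.LaxMor.isStrict_iff.1 (TwoMonad.LaxMor.isStrict_id _)).symm))

theorem StructureCells.laxMap_comp {X Y Z : 𝔸.Obj} (f : X ⟶ Y) (g : Y ⟶ Z) :
    S.laxMap (f ≫ g) = (S.laxMap f).comp (S.laxMap g) :=
  TwoMonad.LaxMor.ext_cell (H.map_comp f g) ((S.mk_cell_laxMap (f ≫ g)).trans
    (OComp.unique (S.isNatural.comp f g)
      (TwoMonad.LaxMor.oComp_comp rfl rfl (S.mk_cell_laxMap f) (S.mk_cell_laxMap g))))

/-- The extension of the comparison 2-functor to loose morphisms. -/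
def StructureCells.laxExtension : StrictPseudofunctor 𝔸.Obj adj.monad.LaxAlg :=
  .mk'' {
    obj X := ⟨adj.comparisonAlgebra X⟩
    map f := S.laxMap f
    map₂ α := S.laxMap₂ α
    map₂_id f := TwoMonad.LaxMor₂.ext (H.map₂_id f)
    map₂_comp α β := TwoMonad.LaxMor₂.ext (H.map₂_comp α β)
    map_id X := S.laxMap_id X
    map_comp f g := S.laxMap_comp f g
    map₂_whisker_left f g g' α := TwoMonad.LaxMor₂.ext (by
      refine Eq.trans ?_ (TwoMonad.LaxAlg.conj_hom (S.laxMap_comp f g)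
        (S.laxMap_comp f g').symm _).symm
      exact H.map₂_whiskerLeft_eqToHom f α)
    map₂_whisker_right {_ _ _ f f'} α g := TwoMonad.LaxMor₂.ext (by
      refine Eq.trans ?_ (TwoMonad.LaxAlg.conj_hom (S.laxMap_comp f g)
        (S.laxMap_comp f' g).symm _).symm
      exact H.map₂_whiskerRight_eqToHom α g) }

theorem StructureCells.isStrict_laxExtension {X Y : 𝔸.Obj} {f : X ⟶ Y} (hf : 𝔸.IsTight f) :
    TwoMonad.LaxMor.IsStrict ((S.laxExtension).map f) :=
  TwoMonad.LaxMor.isStrict_iff.2 (S.mk_cell_laxMap_of_tight hf)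

theorem StructureCells.tightInclusion_comp_laxExtension :
    𝔸.tightInclusion.comp (S.laxExtension) = adj.comparison.comp adj.monad.strictToLax := by
  have h {X Y : 𝔸.Tight} (f : X ⟶ Y) :
      (S.laxExtension).map f.hom = (adj.comparison.comp adj.monad.strictToLax).map f :=
    TwoMonad.LaxMor.ext_cell rfl
      ((S.mk_cell_laxMap_of_tight f.tight).trans (mk_eqToHom (adj.comparison.map f).comm).symm)
  exact StrictPseudofunctor.ext_of_heq (fun _ => rfl) (fun f => heq_of_eq (h f))
    fun {X Y f g} α => TwoMonad.LaxMor₂.heq_of_mk_hom_eq (h f) (h g) rfl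

theorem StructureCells.laxExtension_comp_forget :
    (S.laxExtension).comp adj.monad.laxForget = H.toStrictPseudofunctor :=
  StrictPseudofunctor.ext_of_heq (fun _ => rfl) (fun _ => .rfl) fun _ => .rfl

/-- Lying over `H` fixes the underlying 1-cells and 2-cells, so only the structure 2-cells are in
question. Functoriality and strictness on tight morphisms make them an `IsNatural` family, of which
there is just one. -/
theorem StructureCells.eq_laxExtension {E : StrictPseudofunctor 𝔸.Obj adj.monad.LaxAlg}
    (hobj : ∀ X, E.obj X = ⟨adj.comparisonAlgebra X⟩)
    (hE : E.comp adj.monad.laxForget = H.toStrictPseudofunctor)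
    (hs : ∀ {X Y : 𝔸.Obj} {f : X ⟶ Y}, 𝔸.IsTight f → TwoMonad.LaxMor.IsStrict (E.map f)) :
    E = S.laxExtension := by
  obtain ⟨⟨⟨⟨⟨⟨obj, map⟩, map₂⟩, h₁, h₂⟩, mapId, mapComp, h₃, h₄, h₅, h₆, h₇⟩, h₈, h₉⟩, h₁₀, h₁₁⟩ := E
  obtain rfl : obj = fun X => ⟨adj.comparisonAlgebra X⟩ := funext hobj
  have hmap₂ {X Y : 𝔸.Obj} {f g : X ⟶ Y} (α : f ⟶ g) :
      TwoCell.mk (map₂ α).hom = TwoCell.map H.toStrictPseudofunctor ⟨α⟩ :=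
    eq_of_heq (TwoCell.map_heq_of_eq hE ⟨α⟩)
  -- The bundled image of an identity 2-cell remembers the underlying 1-cell, so agreement on
  -- 1-cells is read off from agreement on 2-cells.
  have hmap {X Y : 𝔸.Obj} (f : X ⟶ Y) : (map f).hom = H.map f :=
    congrArg TwoCell.src (hmap₂ (𝟙 f))
  have hk : adj.tightCounit.IsNatural H.toStrictPseudofunctor .lax
      (fun f => TwoCell.mk (map f).cell) := {
    of_tight := by
      intro X Y f hf
      refine (TwoMonad.LaxMor.isStrict_iff.1 (hs hf)).trans ?_
      exact congrArg (fun a => TwoCell.one ((adj.comparisonAlgebra X).str ≫ a)) (hmap f)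
    comp := by
      intro X Y Z f g
      have h := TwoMonad.LaxMor.oComp_comp (hmap f) (hmap g) rfl rfl
      have e : TwoMonad.LaxMor.comp (map f) (map g) = map (f ≫ g) := (h₁₀ f g).symm
      rw [e] at h
      exact h
    cell := fun a => TwoMonad.LaxMor₂.oComp (hmap₂ a.hom) }
  have hmap' {X Y : 𝔸.Obj} (f : X ⟶ Y) : map f = (S.laxExtension).map f :=
    TwoMonad.LaxMor.ext_cell (hmap f)
      ((S.eq_cell hk f).trans
        (S.mk_cell_laxMap f).symm)
  exact StrictPseudofunctor.ext_of_heq (fun _ => rfl) (fun f => heq_of_eq (hmap' f))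
    fun {X Y f g} α => TwoMonad.LaxMor₂.heq_of_mk_hom_eq (hmap' f) (hmap' g) (hmap₂ α)

end Lax

section Colax

variable {adj} (S : adj.StructureCells .colax)

/-- The colax morphism of algebras over the value of `H` at a loose morphism. -/
def StructureCells.colaxMap {X Y : 𝔸.Obj} (f : X ⟶ Y) :
    TwoMonad.ColaxMor (adj.comparisonAlgebra X) (adj.comparisonAlgebra Y) :=
  .ofTwoCell (H.map f) (S.cell f)
    (S.cod_cell f)
    (S.dom_cell f)
    (S.wl_one_cell f) (S.oComp_map_cell f)

theorem StructureCells.mk_cell_colaxMap {X Y : 𝔸.Obj} (f : X ⟶ Y) :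
    TwoCell.mk (S.colaxMap f).cell = S.cell f :=
  TwoMonad.ColaxMor.mk_cell_ofTwoCell ..

theorem StructureCells.mk_cell_colaxMap_of_tight {X Y : 𝔸.Obj} {f : X ⟶ Y} (hf : 𝔸.IsTight f) :
    TwoCell.mk (S.colaxMap f).cell = TwoCell.one ((adj.comparisonAlgebra X).str ≫ H.map f) :=
  (S.mk_cell_colaxMap f).trans
    (S.isNatural.of_tight hf)

/-- The 2-cell of colax morphisms of algebras over the value of `H` at a 2-cell. -/
def StructureCells.colaxMap₂ {X Y : 𝔸.Obj} {f g : X ⟶ Y} (α : f ⟶ g) :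
    TwoMonad.ColaxMor₂ (S.colaxMap f) (S.colaxMap g) where
  hom := H.map₂ α
  comm := TwoMonad.ColaxMor₂.comm_of_oComp (S.mk_cell_colaxMap f) (S.mk_cell_colaxMap g)
    (S.isNatural.cell ⟨α⟩)

theorem StructureCells.colaxMap_id (X : 𝔸.Obj) : S.colaxMap (𝟙 X) = TwoMonad.ColaxMor.id _ :=
  TwoMonad.ColaxMor.ext_cell (H.map_id X) ((S.mk_cell_colaxMap_of_tight (𝔸.isTight_id X)).trans
    ((congrArg (fun a => TwoCell.one ((adj.comparisonAlgebra X).str ≫ a)) (H.map_id X)).trans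
      (TwoMonad.ColaxMor.isStrict_iff.1 (TwoMonad.ColaxMor.isStrict_id _)).symm))

theorem StructureCells.colaxMap_comp {X Y Z : 𝔸.Obj} (f : X ⟶ Y) (g : Y ⟶ Z) :
    S.colaxMap (f ≫ g) = (S.colaxMap f).comp (S.colaxMap g) :=
  TwoMonad.ColaxMor.ext_cell (H.map_comp f g) ((S.mk_cell_colaxMap (f ≫ g)).trans
    (OComp.unique (S.isNatural.comp f g)
      (TwoMonad.ColaxMor.oComp_comp rfl rfl (S.mk_cell_colaxMap f) (S.mk_cell_colaxMap g))))

/-- The extension of the comparison 2-functor to loose morphisms. -/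
def StructureCells.colaxExtension : StrictPseudofunctor 𝔸.Obj adj.monad.ColaxAlg :=
  .mk'' {
    obj X := ⟨adj.comparisonAlgebra X⟩
    map f := S.colaxMap f
    map₂ α := S.colaxMap₂ α
    map₂_id f := TwoMonad.ColaxMor₂.ext (H.map₂_id f)
    map₂_comp α β := TwoMonad.ColaxMor₂.ext (H.map₂_comp α β)
    map_id X := S.colaxMap_id X
    map_comp f g := S.colaxMap_comp f g
    map₂_whisker_left f g g' α := TwoMonad.ColaxMor₂.ext (by
      refine Eq.trans ?_ (TwoMonad.ColaxAlg.conj_hom (S.colaxMap_comp f g)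
        (S.colaxMap_comp f g').symm _).symm
      exact H.map₂_whiskerLeft_eqToHom f α)
    map₂_whisker_right {_ _ _ f f'} α g := TwoMonad.ColaxMor₂.ext (by
      refine Eq.trans ?_ (TwoMonad.ColaxAlg.conj_hom (S.colaxMap_comp f g)
        (S.colaxMap_comp f' g).symm _).symm
      exact H.map₂_whiskerRight_eqToHom α g) }

theorem StructureCells.isStrict_colaxExtension {X Y : 𝔸.Obj} {f : X ⟶ Y} (hf : 𝔸.IsTight f) :
    TwoMonad.ColaxMor.IsStrict ((S.colaxExtension).map f) :=
  TwoMonad.ColaxMor.isStrict_iff.2 (S.mk_cell_colaxMap_of_tight hf)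

theorem StructureCells.tightInclusion_comp_colaxExtension :
    𝔸.tightInclusion.comp (S.colaxExtension) = adj.comparison.comp adj.monad.strictToColax := by
  have h {X Y : 𝔸.Tight} (f : X ⟶ Y) :
      (S.colaxExtension).map f.hom = (adj.comparison.comp adj.monad.strictToColax).map f :=
    TwoMonad.ColaxMor.ext_cell rfl
      ((S.mk_cell_colaxMap_of_tight f.tight).trans ((mk_eqToHom (adj.comparison.map f).comm.symm).trans
        (congrArg TwoCell.one (adj.comparison.map f).comm)).symm)
  exact StrictPseudofunctor.ext_of_heq (fun _ => rfl) (fun f => heq_of_eq (h f))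
    fun {X Y f g} α => TwoMonad.ColaxMor₂.heq_of_mk_hom_eq (h f) (h g) rfl

theorem StructureCells.colaxExtension_comp_forget :
    (S.colaxExtension).comp adj.monad.colaxForget = H.toStrictPseudofunctor :=
  StrictPseudofunctor.ext_of_heq (fun _ => rfl) (fun _ => .rfl) fun _ => .rfl

theorem StructureCells.eq_colaxExtension {E : StrictPseudofunctor 𝔸.Obj adj.monad.ColaxAlg}
    (hobj : ∀ X, E.obj X = ⟨adj.comparisonAlgebra X⟩)
    (hE : E.comp adj.monad.colaxForget = H.toStrictPseudofunctor)
    (hs : ∀ {X Y : 𝔸.Obj} {f : X ⟶ Y}, 𝔸.IsTight f → TwoMonad.ColaxMor.IsStrict (E.map f)) :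
    E = S.colaxExtension := by
  -- Taking `E` apart lets its object part be replaced by the prescribed algebras, so that its
  -- morphisms have the right type on the nose.
  obtain ⟨⟨⟨⟨⟨⟨obj, map⟩, map₂⟩, h₁, h₂⟩, mapId, mapComp, h₃, h₄, h₅, h₆, h₇⟩, h₈, h₉⟩, h₁₀, h₁₁⟩ := E
  obtain rfl : obj = fun X => ⟨adj.comparisonAlgebra X⟩ := funext hobj
  have hmap₂ {X Y : 𝔸.Obj} {f g : X ⟶ Y} (α : f ⟶ g) :
      TwoCell.mk (map₂ α).hom = TwoCell.map H.toStrictPseudofunctor ⟨α⟩ :=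
    eq_of_heq (TwoCell.map_heq_of_eq hE ⟨α⟩)
  have hmap {X Y : 𝔸.Obj} (f : X ⟶ Y) : (map f).hom = H.map f :=
    congrArg TwoCell.src (hmap₂ (𝟙 f))
  have hk : adj.tightCounit.IsNatural H.toStrictPseudofunctor .colax
      (fun f => TwoCell.mk (map f).cell) := {
    of_tight := by
      intro X Y f hf
      refine (TwoMonad.ColaxMor.isStrict_iff.1 (hs hf)).trans ?_
      exact congrArg (fun a => TwoCell.one ((adj.comparisonAlgebra X).str ≫ a)) (hmap f)
    comp := by
      intro X Y Z f g
      have h := TwoMonad.ColaxMor.oComp_comp (hmap f) (hmap g) rfl rfl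
      have e : TwoMonad.ColaxMor.comp (map f) (map g) = map (f ≫ g) := (h₁₀ f g).symm
      rw [e] at h
      exact h
    cell := fun a => TwoMonad.ColaxMor₂.oComp (hmap₂ a.hom) }
  have hmap' {X Y : 𝔸.Obj} (f : X ⟶ Y) : map f = (S.colaxExtension).map f :=
    TwoMonad.ColaxMor.ext_cell (hmap f)
      ((S.eq_cell hk f).trans
        (S.mk_cell_colaxMap f).symm)
  exact StrictPseudofunctor.ext_of_heq (fun _ => rfl) (fun f => heq_of_eq (hmap' f))
    fun {X Y f g} α => TwoMonad.ColaxMor₂.heq_of_mk_hom_eq (hmap' f) (hmap' g) (hmap₂ α)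

end Colax

section Pseudo

variable {adj} (S : adj.StructureCells .pseudo)

/-- The extension of the comparison 2-functor to loose morphisms, with values in
pseudomorphisms. -/
def StructureCells.pseudoExtension :
    StrictPseudofunctor 𝔸.Obj adj.monad.pseudoLaxFCategory.Tight :=
  FCategory.liftTight (𝔸 := adj.monad.pseudoLaxFCategory) S.toLax.laxExtension fun f =>
    isIso_cast (S.toLax.dom_cell f) (S.toLax.cod_cell f) (S.isIso_cell rfl f)

theorem StructureCells.pseudoExtension_comp_tightInclusion :
    S.pseudoExtension.comp adj.monad.pseudoLaxFCategory.tightInclusion = S.toLax.laxExtension :=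
  StrictPseudofunctor.ext_of_heq (fun _ => rfl) (fun _ => .rfl) fun _ => .rfl

/-- Pseudomorphisms are the lax morphisms with invertible 2-cell, so the equation may be checked
after including them in lax morphisms, where it is the lax one. -/
theorem StructureCells.tightInclusion_comp_pseudoExtension :
    𝔸.tightInclusion.comp S.pseudoExtension = adj.comparison.comp adj.monad.strictToPseudo := by
  have h₁ : (𝔸.tightInclusion.comp S.pseudoExtension).comp
      adj.monad.pseudoLaxFCategory.tightInclusion =
      𝔸.tightInclusion.comp S.toLax.laxExtension :=
    StrictPseudofunctor.ext_of_heq (fun _ => rfl) (fun _ => .rfl) fun _ => .rfl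
  have h₂ : adj.comparison.comp adj.monad.strictToLax =
      (adj.comparison.comp adj.monad.strictToPseudo).comp
        adj.monad.pseudoLaxFCategory.tightInclusion :=
    StrictPseudofunctor.ext_of_heq (fun _ => rfl) (fun _ => .rfl) fun _ => .rfl
  exact StrictPseudofunctor.comp_tightInclusion_injective
    (h₁.trans (S.toLax.tightInclusion_comp_laxExtension.trans h₂))

theorem StructureCells.pseudoExtension_comp_forget :
    S.pseudoExtension.comp (adj.monad.pseudoLaxFCategory.tightInclusion.comp
      adj.monad.laxForget) = H.toStrictPseudofunctor :=
  StrictPseudofunctor.ext_of_heq (fun _ => rfl) (fun _ => .rfl) fun _ => .rfl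

theorem StructureCells.eq_pseudoExtension
    {E : StrictPseudofunctor 𝔸.Obj adj.monad.pseudoLaxFCategory.Tight}
    (hobj : ∀ X, E.obj X = ⟨⟨adj.comparisonAlgebra X⟩⟩)
    (hE : E.comp (adj.monad.pseudoLaxFCategory.tightInclusion.comp adj.monad.laxForget) =
      H.toStrictPseudofunctor)
    (hs : ∀ {X Y : 𝔸.Obj} {f : X ⟶ Y}, 𝔸.IsTight f → TwoMonad.LaxMor.IsStrict (E.map f).hom) :
    E = S.pseudoExtension := by
  have h : (E.comp adj.monad.pseudoLaxFCategory.tightInclusion).comp adj.monad.laxForget =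
      E.comp (adj.monad.pseudoLaxFCategory.tightInclusion.comp adj.monad.laxForget) :=
    StrictPseudofunctor.ext_of_heq (fun _ => rfl) (fun _ => .rfl) fun _ => .rfl
  exact StrictPseudofunctor.comp_tightInclusion_injective
    ((S.toLax.eq_laxExtension (fun X => congrArg FCategory.Tight.obj (hobj X)) (h.trans hE)
      hs).trans S.pseudoExtension_comp_tightInclusion.symm)

end Pseudo

end TwoAdjunction

/-! ### The extension theorem for the three values of `w`. -/

theorem mainTheorem3 (w : Weakness) (𝔸 : FCategory.{w₁, v₁, u₁}) (B : Type u₂)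
    [Bicategory.{w₂, v₂} B] [Bicategory.Strict B] (H : FFunctor 𝔸 (FCategory.ofTwoCategory B))
    (F : StrictPseudofunctor B 𝔸.Tight) (adj : TwoAdjunction F H.tightPart)
    (hlim : 𝔸.HasBarLimits w) :
    ∃! E : FFunctor 𝔸 (adj.monad.algFCategory w),
      𝔸.j.comp E = (FFunctor.ofTwoFunctor adj.comparison).comp (adj.monad.algInclusion w) ∧
      E.comp (adj.monad.forget w) = H := by
  -- The choice of limits is harmless: `eq_cell` shows that the resulting 2-cells do not depend on
  -- it.
  let S := adj.structureCells fun f => (hlim.nonempty_resolution f).some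
  cases w
  case lax =>
    refine ⟨⟨S.laxExtension, fun _ hf => S.isStrict_laxExtension hf⟩,
      ⟨FFunctor.ext_toStrictPseudofunctor S.tightInclusion_comp_laxExtension,
        FFunctor.ext_toStrictPseudofunctor S.laxExtension_comp_forget⟩, fun E ⟨h₁, h₂⟩ => ?_⟩
    exact FFunctor.ext_toStrictPseudofunctor (S.eq_laxExtension
      -- Every object of `𝔸` is an object of its tight part, so extending the comparison already
      -- fixes the extension on objects.
      (fun X => congrArg (fun D => D.obj (⟨X⟩ : 𝔸.Tight)) h₁)
      (congrArg FFunctor.toStrictPseudofunctor h₂) (E.map_tight _))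
  case pseudo =>
    refine ⟨⟨S.pseudoExtension, fun _ hf => S.toLax.isStrict_laxExtension hf⟩,
      ⟨FFunctor.ext_toStrictPseudofunctor S.tightInclusion_comp_pseudoExtension,
        FFunctor.ext_toStrictPseudofunctor S.pseudoExtension_comp_forget⟩, fun E ⟨h₁, h₂⟩ => ?_⟩
    exact FFunctor.ext_toStrictPseudofunctor (S.eq_pseudoExtension
      (fun X => congrArg (fun D => D.obj (⟨X⟩ : 𝔸.Tight)) h₁)
      (congrArg FFunctor.toStrictPseudofunctor h₂) (E.map_tight _))
  case colax =>
    refine ⟨⟨S.colaxExtension, fun _ hf => S.isStrict_colaxExtension hf⟩,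
      ⟨FFunctor.ext_toStrictPseudofunctor S.tightInclusion_comp_colaxExtension,
        FFunctor.ext_toStrictPseudofunctor S.colaxExtension_comp_forget⟩, fun E ⟨h₁, h₂⟩ => ?_⟩
    exact FFunctor.ext_toStrictPseudofunctor (S.eq_colaxExtension
      (fun X => congrArg (fun D => D.obj (⟨X⟩ : 𝔸.Tight)) h₁)
      (congrArg FFunctor.toStrictPseudofunctor h₂) (E.map_tight _))
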